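/- Let $N\ge 1$, let $U\subset\mathbb{R}^N$ be a non-empty bounded open set (for instance a bounded smooth domain), $I=[0,1]$, and $A=\operatorname{diag}(-1,\dots,-1,1,\dots,1)$ the $p\times p$ matrix with $p_1$ entries $-1$ and $p-p_1$ entries $1$, $0\le p_1\le p$. Let $F:I\times U\times\mathbb{R}^p\to\mathbb{R}$ be such that (A1) $F$ is of class $C^2$; (A2) $0$ is a critical point of $F(\lambda,x,\cdot)$ for all $(\lambda,x)\in I\times U$; (A3) if $N\ge 2$, there are $C>0$ and $s\ge 1$, with $s<\frac{N+2}{N-2}$ if $N\ge 3$, such that $|\nabla_u^2F(\lambda,x,u)|\le C(1+|u|^{s-1})$ for all $\lambda\in I$, $x\in U$, $u\in\mathbb{R}^p$; and assume that the Hessian matrix $B_\lambda:=\nabla^2_uF(\lambda,x,0)$ does not depend on $x\in U$. Let $H^1_0(U)$ be the closure of $C_c^\infty(U)$ in $H^1(U)$, with the scalar product $\int_U\langle\nabla u,\nabla v\rangle\,dx$, and let $H=(H^1_0(U))^p$ with $\langle u,v\rangle_H=\sum_i\langle u_i,v_i\rangle_{H_0^1(U)}$. Let $L_\lambda=T+K_\lambda$,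 $\lambda\in I$, be the bounded operators on $H$ given by $$Tu=-Au,\qquad \langle K_\lambda u,v\rangle_H=-\int_U\langle B_\lambda u(x),v(x)\rangle\,dx .$$ Let $0<\alpha_1\le\alpha_2\le\dots$ be the eigenvalues, repeated according to multiplicity, of the Dirichlet problem $-\Delta u=\alpha u$ in $U$, $u=0$ on $\partial U$ (with weak solutions $u\in H^1_0(U)$). For a real symmetric matrix $M$ let $\operatorname{sgn}(M)$ be the number of its positive eigenvalues minus the number of its negative eigenvalues, counted with multiplicity, and set $$i(B_\lambda)=\frac12\sum_{k=1}^\infty\Bigl(\operatorname{sgn}\bigl(-A-\tfrac1{\alpha_k}B_\lambda\bigr)-\operatorname{sgn}(-A)\Bigr).$$ Assume that for $\lambda=0$ and for $\lambda=1$ the linearised problem $$A\Delta u=B_\lambda u\ \text{ in }U,\qquad u=0\ \text{ on }\partial U,$$ has only the trivial weak solution $u=0$ in $H$. Then, for every $\lambda\in I$, only finitely many terms of the series for $i(B_\lambda)$ are non-zero; $L=\{L_\lambda\}_{\lambda\in I}$ is a (norm-)continuous path of selfadjoint Fredholm operators with invertible endpoints; and its spectral flow satisfies $$\operatorname{sf}(L)=i(B_1)-i(B_0).$$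 Here $\operatorname{sf}(L)$ is the following integer, which exists and does not depend on the choices (this is part of the claim): choose $0=t_0\le t_1\le\dots\le t_n=1$ and $a_1,\dots,a_n>0$ such that, for all $\lambda\in[t_{j-1},t_j]$, $\pm a_j\notin\sigma(L_\lambda)$ and $\sigma(L_\lambda)\cap[-a_j,a_j]$ consists of finitely many eigenvalues of finite multiplicity; then $$\operatorname{sf}(L)=\sum_{j=1}^n\bigl(\dim E_{[0,a_j]}(L_{t_j})-\dim E_{[0,a_j]}(L_{t_{j-1}})\bigr),$$ where $E_{[0,a]}(S)$ is the sum of the eigenspaces of $S$ for eigenvalues in $[0,a]$. -/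

import Mathlib

open MeasureTheory Set
open scoped ContDiff

noncomputable section

namespace EllipticSF

/-! ### The Hilbert space `H = (H¹₀(U))^p` -/

/-- Euclidean space `ℝⁿ` with the Euclidean norm. -/
abbrev E (n : ℕ) : Type := EuclideanSpace ℝ (Fin n)

/-- A non-empty bounded open subset of `ℝᴺ`. -/
structure BoundedOpen (N : ℕ) where
  carrier : Set (E N)
  isOpen : IsOpen carrier
  isBounded : Bornology.IsBounded carrier
  nonempty : carrier.Nonempty

variable {N : ℕ}

/-- `L²(U)`. -/
abbrev L2 (U : BoundedOpen N) : Type := Lp ℝ 2 (volume.restrict U.carrier)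

/-- `L²(U; ℝᴺ)`. -/
abbrev L2vec (U : BoundedOpen N) : Type := Lp (E N) 2 (volume.restrict U.carrier)

/-- `φ ∈ C_c^∞(U)`. -/
structure IsTest (U : BoundedOpen N) (φ : E N → ℝ) : Prop where
  smooth : ContDiff ℝ ∞ φ
  compact : HasCompactSupport φ
  support : tsupport φ ⊆ U.carrier

theorem IsTest.zero (U : BoundedOpen N) : IsTest U (fun _ => 0) :=
  ⟨contDiff_const, HasCompactSupport.zero, by
    have : tsupport (fun _ : E N => (0 : ℝ)) = ∅ := tsupport_eq_empty_iff.2 rfl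
    simp [this]⟩

theorem IsTest.add {U : BoundedOpen N} {φ ψ : E N → ℝ} (hφ : IsTest U φ) (hψ : IsTest U ψ) :
    IsTest U (fun x => φ x + ψ x) :=
  ⟨hφ.smooth.add hψ.smooth, hφ.compact.add hψ.compact,
    (tsupport_add φ ψ).trans (union_subset hφ.support hψ.support)⟩

theorem IsTest.smul {U : BoundedOpen N} {φ : E N → ℝ} (c : ℝ) (hφ : IsTest U φ) :
    IsTest U (fun x => c * φ x) :=
  ⟨contDiff_const.mul hφ.smooth, hφ.compact.mul_left,
    (closure_mono (fun x hx => by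
      simp only [Function.mem_support] at hx ⊢
      exact right_ne_zero_of_mul hx)).trans hφ.support⟩

theorem IsTest.differentiable {U : BoundedOpen N} {φ : E N → ℝ} (hφ : IsTest U φ) :
    Differentiable ℝ φ :=
  hφ.smooth.differentiable (by simp)

/-- The pairs `(φ, ∇φ) ∈ L²(U) × L²(U; ℝᴺ)` with `φ ∈ C_c^∞(U)`. -/
def testGraph (U : BoundedOpen N) : Submodule ℝ (L2 U × L2vec U) where
  carrier := {w | ∃ φ : E N → ℝ, IsTest U φ ∧
    (w.1 : E N → ℝ) =ᵐ[volume.restrict U.carrier] φ ∧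
    (w.2 : E N → E N) =ᵐ[volume.restrict U.carrier] gradient φ}
  zero_mem' := by
    refine ⟨fun _ => 0, IsTest.zero U, Lp.coeFn_zero _ _ _, ?_⟩
    refine (Lp.coeFn_zero _ _ _).trans ?_
    filter_upwards with x
    simp [gradient]
  add_mem' := by
    rintro v w ⟨φ, hφ, h1, h2⟩ ⟨ψ, hψ, h3, h4⟩
    refine ⟨_, hφ.add hψ, ?_, ?_⟩
    · filter_upwards [Lp.coeFn_add v.1 w.1, h1, h3] with x hx h1 h3
      simp only [Prod.fst_add, hx, Pi.add_apply, h1, h3]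
    · filter_upwards [Lp.coeFn_add v.2 w.2, h2, h4] with x hx h2 h4
      simp only [Prod.snd_add, hx, Pi.add_apply, h2, h4, gradient]
      rw [fderiv_fun_add (hφ.differentiable x) (hψ.differentiable x), map_add]
  smul_mem' := by
    rintro c w ⟨φ, hφ, h1, h2⟩
    refine ⟨_, hφ.smul c, ?_, ?_⟩
    · filter_upwards [Lp.coeFn_smul c w.1, h1] with x hx h1
      simp only [Prod.smul_fst, hx, Pi.smul_apply, h1, smul_eq_mul]
    · filter_upwards [Lp.coeFn_smul c w.2, h2] with x hx h2
      simp only [Prod.smul_snd, hx, Pi.smul_apply, h2, gradient]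
      rw [fderiv_const_mul (hφ.differentiable x), map_smulₛₗ]
      simp

/-- The closure of `{(φ, ∇φ) : φ ∈ C_c^∞(U)}` in `L²(U) × L²(U; ℝᴺ)`, that is, the closure of
`C_c^∞(U)` in `H¹(U)`, each `u` being recorded together with its weak gradient. -/
def graphClosure (U : BoundedOpen N) : Submodule ℝ (L2 U × L2vec U) :=
  (testGraph U).topologicalClosure

/-- The Sobolev space `H¹₀(U)`. -/
def H01 (U : BoundedOpen N) : Type := graphClosure U

instance (U : BoundedOpen N) : AddCommGroup (H01 U) :=
  inferInstanceAs (AddCommGroup (graphClosure U))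

instance (U : BoundedOpen N) : Module ℝ (H01 U) :=
  inferInstanceAs (Module ℝ (graphClosure U))

/-- The class of `u` in `L²(U)`. -/
def valL (U : BoundedOpen N) : H01 U →ₗ[ℝ] L2 U :=
  LinearMap.fst ℝ _ _ ∘ₗ (graphClosure U).subtype

/-- The weak gradient of `u`. -/
def gradL (U : BoundedOpen N) : H01 U →ₗ[ℝ] L2vec U :=
  LinearMap.snd ℝ _ _ ∘ₗ (graphClosure U).subtype

/-- Poincaré's inequality for test functions. -/
theorem poincare_test [NeZero N] (U : BoundedOpen N) {R : ℝ}
    (hUR : ∀ x ∈ U.carrier, ‖x‖ ≤ R) {φ : E N → ℝ} (hφ : IsTest U φ) :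
    ∫ x, φ x ^ 2 ≤ 4 * R ^ 2 * ∫ x, ‖gradient φ x‖ ^ 2 := by
  set e : E N := EuclideanSpace.single 0 1 with he
  set l : E N → ℝ := fun x => x 0 with hl
  have hc : Continuous φ := hφ.smooth.continuous
  have hlc : Continuous l := by fun_prop
  have hld : Differentiable ℝ l := by fun_prop
  have hlf : ∀ x, fderiv ℝ l x e = 1 := by
    intro x
    have : l = (EuclideanSpace.proj (0 : Fin N) : E N →L[ℝ] ℝ) := by
      ext x; simp [hl]
    rw [this, ContinuousLinearMap.fderiv]
    simp [he]
  have hdc : Continuous (fun x => fderiv ℝ φ x) := hφ.smooth.continuous_fderiv (by simp)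
  have hgc : Continuous (gradient φ) :=
    (InnerProductSpace.toDual ℝ (E N)).symm.continuous.comp hdc
  have hd2 : ∀ x, fderiv ℝ (fun y => φ y ^ 2) x e = 2 * φ x * fderiv ℝ φ x e := by
    intro x
    rw [fderiv_fun_pow 2 (hφ.differentiable x)]
    simp
  have hsupp2 : HasCompactSupport (fun x => φ x ^ 2) :=
    hφ.compact.comp_left (g := fun y : ℝ => y ^ 2) (by simp)
  have hdsupp : HasCompactSupport (fun x => fderiv ℝ φ x) := hφ.compact.fderiv ℝ
  have hgsupp : HasCompactSupport (fun x => ‖gradient φ x‖ ^ 2) := by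
    refine hdsupp.comp_left
      (g := fun m => ‖(InnerProductSpace.toDual ℝ (E N)).symm m‖ ^ 2) (by simp)
  have I1 : Integrable (fun x => φ x ^ 2) :=
    (hc.pow 2).integrable_of_hasCompactSupport hsupp2
  have I2 : Integrable (fun x => ‖gradient φ x‖ ^ 2) :=
    (hgc.norm.pow 2).integrable_of_hasCompactSupport hgsupp
  have I3 : Integrable (fun x => l x * fderiv ℝ (fun y => φ y ^ 2) x e) := by
    simp_rw [hd2]
    refine Continuous.integrable_of_hasCompactSupport
      (hlc.mul ((continuous_const.mul hc).mul (hdc.clm_apply continuous_const))) ?_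
    exact ((hφ.compact.mul_left (f := fun _ => (2 : ℝ))).mul_right
      (f' := fun x => fderiv ℝ φ x e)).mul_left (f := l)
  have key := integral_mul_fderiv_eq_neg_fderiv_mul_of_integrable (μ := (volume : Measure (E N)))
    (f := l) (g := fun x => φ x ^ 2) (v := e) (by simpa [hlf] using I1) I3
    ((hlc.mul (hc.pow 2)).integrable_of_hasCompactSupport hsupp2.mul_left)
    (fun x _ => hld x) (fun x _ => (hφ.differentiable x).pow 2)
  simp only [hlf, one_mul] at key
  have hpt : ∀ x, -(l x * fderiv ℝ (fun y => φ y ^ 2) x e) ≤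
      (1 / 2) * φ x ^ 2 + 2 * R ^ 2 * ‖gradient φ x‖ ^ 2 := by
    intro x
    rw [hd2]
    by_cases hx : x ∈ U.carrier
    · have h1 : |l x| ≤ R := by
        have := PiLp.norm_apply_le x 0
        exact (by simpa [hl] using this : |l x| ≤ ‖x‖).trans (hUR x hx)
      have h2 : |fderiv ℝ φ x e| ≤ ‖gradient φ x‖ := by
        have h3 : ‖gradient φ x‖ = ‖fderiv ℝ φ x‖ := by
          simp [gradient]
        rw [h3]
        have := (fderiv ℝ φ x).le_opNorm e
        simpa [he] using this
      have h4 : |l x * fderiv ℝ φ x e| ≤ R * ‖gradient φ x‖ := by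
        rw [abs_mul]
        exact mul_le_mul h1 h2 (abs_nonneg _) ((abs_nonneg _).trans h1)
      have h5 : (l x * fderiv ℝ φ x e) ^ 2 ≤ (R * ‖gradient φ x‖) ^ 2 :=
        sq_le_sq' (abs_le.1 h4).1 (abs_le.1 h4).2
      nlinarith [sq_nonneg (φ x + 2 * (l x * fderiv ℝ φ x e))]
    · have : φ x = 0 := by
        by_contra h
        exact hx (hφ.support (subset_tsupport φ h))
      rw [this]
      simp only [mul_zero, zero_mul, neg_zero]
      positivity
  have hint : ∫ x, φ x ^ 2 ≤ ∫ x, ((1 / 2) * φ x ^ 2 + 2 * R ^ 2 * ‖gradient φ x‖ ^ 2) := by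
    have h6 : ∫ x, φ x ^ 2 = ∫ x, -(l x * fderiv ℝ (fun y => φ y ^ 2) x e) := by
      rw [integral_neg, key, neg_neg]
    rw [h6]
    exact integral_mono I3.neg ((I1.const_mul _).add (I2.const_mul _)) hpt
  rw [integral_add (I1.const_mul _) (I2.const_mul _), integral_const_mul,
    integral_const_mul] at hint
  linarith

theorem norm_sq_L2 {F : Type*} [NormedAddCommGroup F] [InnerProductSpace ℝ F]
    {μ : Measure (E N)} (f : Lp F 2 μ) : ‖f‖ ^ 2 = ∫ x, ‖f x‖ ^ 2 ∂μ := by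
  rw [← real_inner_self_eq_norm_sq, L2.inner_def]
  simp

/-- Poincaré's inequality on `H¹₀(U)`. -/
theorem poincare [NeZero N] (U : BoundedOpen N) :
    ∃ C : ℝ, 0 ≤ C ∧ ∀ u : H01 U, ‖valL U u‖ ≤ C * ‖gradL U u‖ := by
  obtain ⟨R, hR⟩ := U.isBounded.exists_norm_le
  have hR0 : 0 ≤ R := by
    obtain ⟨x, hx⟩ := U.nonempty
    exact (norm_nonneg x).trans (hR x hx)
  refine ⟨2 * R, by positivity, ?_⟩
  have hclosed : IsClosed {w : L2 U × L2vec U | ‖w.1‖ ≤ 2 * R * ‖w.2‖} :=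
    isClosed_le (by fun_prop) (by fun_prop)
  have hsub : (testGraph U : Set (L2 U × L2vec U)) ⊆ {w | ‖w.1‖ ≤ 2 * R * ‖w.2‖} := by
    rintro w ⟨φ, hφ, h1, h2⟩
    have e1 : ‖w.1‖ ^ 2 = ∫ x, φ x ^ 2 := by
      rw [norm_sq_L2, ← setIntegral_eq_integral_of_forall_compl_eq_zero (s := U.carrier)
        (f := fun x => φ x ^ 2)]
      · refine integral_congr_ae ?_
        filter_upwards [h1] with x hx
        simp [hx]
      · intro x hx
        have : φ x = 0 := by
          by_contra h
          exact hx (hφ.support (subset_tsupport φ h))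
        simp [this]
    have e2 : ‖w.2‖ ^ 2 = ∫ x, ‖gradient φ x‖ ^ 2 := by
      rw [norm_sq_L2, ← setIntegral_eq_integral_of_forall_compl_eq_zero (s := U.carrier)
        (f := fun x => ‖gradient φ x‖ ^ 2)]
      · refine integral_congr_ae ?_
        filter_upwards [h2] with x hx
        simp [hx]
      · intro x hx
        have : fderiv ℝ φ x = 0 := by
          by_contra h
          exact hx (hφ.support (support_fderiv_subset ℝ (Function.mem_support.2 h)))
        simp [gradient, this]
    have h := poincare_test U hR hφ
    rw [← e1, ← e2] at h
    have h' : ‖w.1‖ ^ 2 ≤ (2 * R * ‖w.2‖) ^ 2 := by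
      calc ‖w.1‖ ^ 2 ≤ _ := h
        _ = _ := by ring
    exact (le_abs_self _).trans (abs_le_of_sq_le_sq h' (by positivity))
  intro u
  exact closure_minimal hsub hclosed u.2

theorem gradL_injective [NeZero N] (U : BoundedOpen N) : Function.Injective (gradL U) := by
  obtain ⟨C, -, hC⟩ := poincare U
  rw [injective_iff_map_eq_zero]
  intro u hu
  have h := hC u
  rw [hu, norm_zero, mul_zero] at h
  have h' : valL U u = 0 := norm_le_zero_iff.1 h
  exact Subtype.ext (Prod.ext h' hu)

instance [NeZero N] (U : BoundedOpen N) : NormedAddCommGroup (H01 U) :=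
  NormedAddCommGroup.induced (H01 U) (L2vec U) (gradL U) (gradL_injective U)

/-- `H¹₀(U)` carries the scalar product `⟨u, v⟩ = ∫_U ⟨∇u, ∇v⟩ dx`. -/
instance [NeZero N] (U : BoundedOpen N) : InnerProductSpace ℝ (H01 U) where
  norm_smul_le c u := by
    change ‖gradL U (c • u)‖ ≤ ‖c‖ * ‖gradL U u‖
    rw [map_smul, norm_smul]
  inner u v := inner ℝ (gradL U u) (gradL U v)
  norm_sq_eq_re_inner u := norm_sq_eq_re_inner (gradL U u)
  conj_inner_symm u v := inner_conj_symm (gradL U u) (gradL U v)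
  add_left u v w := by
    rw [map_add, inner_add_left]
  smul_left u v c := by
    rw [map_smul, inner_smul_left]

theorem inner_H01 [NeZero N] (U : BoundedOpen N) (u v : H01 U) :
    inner ℝ u v = ∫ x in U.carrier, inner ℝ (gradL U u x) (gradL U v x) :=
  L2.inner_def _ _

instance [NeZero N] (U : BoundedOpen N) : CompleteSpace (H01 U) := by
  obtain ⟨C, hC0, hC⟩ := poincare U
  let e : H01 U ≃ₗ[ℝ] graphClosure U := LinearEquiv.refl ℝ (graphClosure U)
  have h1 : ∀ u : H01 U, ‖e u‖ ≤ max C 1 * ‖u‖ := fun u => by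
    refine max_le ?_ ?_
    · exact (hC u).trans (mul_le_mul_of_nonneg_right (le_max_left _ _) (norm_nonneg _))
    · exact le_mul_of_one_le_left (norm_nonneg (gradL U u)) (le_max_right _ _)
  have h2 : ∀ w : graphClosure U, ‖e.symm w‖ ≤ 1 * ‖w‖ := fun w => by
    rw [one_mul]
    exact le_max_right _ _
  let e' : H01 U ≃L[ℝ] graphClosure U := e.toContinuousLinearEquivOfBounds _ _ h1 h2
  have : CompleteSpace (graphClosure U) :=
    (Submodule.isClosed_topologicalClosure (testGraph U)).completeSpace_coe
  exact (completeSpace_congr (e := e'.toEquiv) e'.isUniformEmbedding).2 this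

/-- The inclusion `H¹₀(U) → L²(U)`. -/
def val [NeZero N] (U : BoundedOpen N) : H01 U →L[ℝ] L2 U :=
  (valL U).mkContinuousOfExistsBound ((poincare U).imp fun _ h => h.2)

/-- The bounded operator `S` on `H¹₀(U)` with `⟨S u, v⟩ = ∫_U u v dx`. -/
def massOp [NeZero N] (U : BoundedOpen N) : H01 U →L[ℝ] H01 U :=
  ContinuousLinearMap.adjoint (val U) ∘L val U

theorem inner_massOp [NeZero N] (U : BoundedOpen N) (u v : H01 U) :
    inner ℝ (massOp U u) v = ∫ x in U.carrier, val U u x * val U v x := by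
  rw [massOp, ContinuousLinearMap.comp_apply, ContinuousLinearMap.adjoint_inner_left, L2.inner_def]
  simp [mul_comm]

/-- `H = H¹₀(U) ⊕ ⋯ ⊕ H¹₀(U)` (`p` summands), with `⟨u, v⟩ = ∑ᵢ ⟨uᵢ, vᵢ⟩`. -/
abbrev H [NeZero N] (U : BoundedOpen N) (p : ℕ) : Type := PiLp 2 (fun _ : Fin p => H01 U)

/-! ### The operators -/

/-- The operator `(uⱼ)ⱼ ↦ (∑ⱼ Mᵢⱼ S uⱼ)ᵢ` on `H`. -/
def matOp [NeZero N] {U : BoundedOpen N} {p : ℕ} (M : Matrix (Fin p) (Fin p) ℝ)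
    (S : H01 U →L[ℝ] H01 U) : H U p →L[ℝ] H U p :=
  ((PiLp.continuousLinearEquiv 2 ℝ (fun _ : Fin p => H01 U)).symm : _ →L[ℝ] H U p) ∘L
    ContinuousLinearMap.pi fun i => ∑ j, M i j • (S ∘L PiLp.proj 2 (fun _ : Fin p => H01 U) j)

theorem matOp_apply [NeZero N] {U : BoundedOpen N} {p : ℕ} (M : Matrix (Fin p) (Fin p) ℝ)
    (S : H01 U →L[ℝ] H01 U) (u : H U p) (i : Fin p) :
    matOp M S u i = ∑ j, M i j • S (u j) := by
  simp [matOp]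

/-- `A = diag(-1, …, -1, 1, …, 1)` with `p₁` entries `-1`. -/
def signMatrix (p p₁ : ℕ) : Matrix (Fin p) (Fin p) ℝ :=
  Matrix.diagonal fun i => if (i : ℕ) < p₁ then -1 else 1

/-- `T u = -A u`. -/
def T [NeZero N] (U : BoundedOpen N) {p : ℕ} (A : Matrix (Fin p) (Fin p) ℝ) :
    H U p →L[ℝ] H U p :=
  matOp (-A) (ContinuousLinearMap.id ℝ (H01 U))

/-- The operator `K` with `⟨K u, v⟩ = -∫_U ⟨B u(x), v(x)⟩ dx`, see `inner_K`. -/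
def K [NeZero N] (U : BoundedOpen N) {p : ℕ} (B : Matrix (Fin p) (Fin p) ℝ) :
    H U p →L[ℝ] H U p :=
  matOp (-B) (massOp U)

theorem integral_sum_val [NeZero N] (U : BoundedOpen N) {p : ℕ}
    (B : Matrix (Fin p) (Fin p) ℝ) (u v : H U p) :
    ∫ x in U.carrier, ∑ i, (∑ j, B i j * val U (u j) x) * val U (v i) x =
      ∑ i, ∑ j, B i j * ∫ x in U.carrier, val U (u j) x * val U (v i) x := by
  have hI : ∀ i j, Integrable (fun x => val U (u j) x * val U (v i) x)
      (volume.restrict U.carrier) := fun i j =>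
    (Lp.memLp (val U (u j))).integrable_mul (Lp.memLp (val U (v i)))
  simp_rw [Finset.sum_mul, mul_assoc]
  refine (integral_finsetSum _ fun i _ =>
    integrable_finsetSum _ fun j _ => (hI i j).const_mul (B i j)).trans ?_
  refine Finset.sum_congr rfl fun i _ => ?_
  refine (integral_finsetSum _ fun j _ => (hI i j).const_mul (B i j)).trans ?_
  exact Finset.sum_congr rfl fun j _ => integral_const_mul _ _

theorem inner_K [NeZero N] (U : BoundedOpen N) {p : ℕ} (B : Matrix (Fin p) (Fin p) ℝ)
    (u v : H U p) :
    inner ℝ (K U B u) v =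
      -∫ x in U.carrier, ∑ i, (∑ j, B i j * val U (u j) x) * val U (v i) x := by
  rw [integral_sum_val, PiLp.inner_apply, ← Finset.sum_neg_distrib]
  refine Finset.sum_congr rfl fun i _ => ?_
  rw [K, matOp_apply, sum_inner, ← Finset.sum_neg_distrib]
  refine Finset.sum_congr rfl fun j _ => ?_
  rw [real_inner_smul_left, inner_massOp, Matrix.neg_apply, neg_mul]

/-- `L = T + K`, the Hessian at `0` of the functional
`u ↦ ½ ∫_U ∑ᵢ -aᵢ |∇uᵢ|² dx - ∫_U F(x, u) dx`, where `A = diag(aᵢ)` and `B = ∇²_u F(x, 0)`. -/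
def hessianOp [NeZero N] (U : BoundedOpen N) {p : ℕ} (A B : Matrix (Fin p) (Fin p) ℝ) :
    H U p →L[ℝ] H U p :=
  T U A + K U B

/-- `u ∈ H` is a weak solution of `A Δu = B u` in `U`, `u = 0` on `∂U`. -/
def IsWeakSolution [NeZero N] (U : BoundedOpen N) {p : ℕ} (A B : Matrix (Fin p) (Fin p) ℝ)
    (u : H U p) : Prop :=
  ∀ v : H U p, -∑ i, ∑ j, A i j * inner ℝ (u j) (v i) =
    ∫ x in U.carrier, ∑ i, (∑ j, B i j * val U (u j) x) * val U (v i) x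

/-- The Hessian matrix of `g : ℝᵖ → ℝ` at `u`. -/
def hessMatrix {p : ℕ} (g : E p → ℝ) (u : E p) : Matrix (Fin p) (Fin p) ℝ :=
  Matrix.of fun i j =>
    fderiv ℝ (fderiv ℝ g) u (EuclideanSpace.single i 1) (EuclideanSpace.single j 1)

/-! ### Dirichlet eigenvalues and the index -/

/-- The weak solutions `u ∈ H¹₀(U)` of `-Δu = α u`. -/
def dirichletEigenspace [NeZero N] (U : BoundedOpen N) (α : ℝ) : Submodule ℝ (H01 U) where
  carrier := {u | ∀ v, inner ℝ u v = α * ∫ x in U.carrier, val U u x * val U v x}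
  zero_mem' v := by
    rw [← inner_massOp]; simp
  add_mem' := by
    intro a b ha hb v
    have ha := ha v
    have hb := hb v
    rw [← inner_massOp] at *
    rw [inner_add_left, ha, hb, map_add, inner_add_left, mul_add]
  smul_mem' := by
    intro c a ha v
    have ha := ha v
    rw [← inner_massOp] at *
    rw [map_smul, real_inner_smul_left, real_inner_smul_left, ha]
    ring

/-- The Dirichlet eigenvalues `α₀ ≤ α₁ ≤ ⋯` of `U` in increasing order, repeated according to
multiplicity: `α k` is the least `a` such that the eigenspaces belonging to eigenvalues `≤ a`
together have dimension at least `k + 1`. -/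
def dirichletEigenvalue [NeZero N] (U : BoundedOpen N) (k : ℕ) : ℝ :=
  sInf {a : ℝ | ((k + 1 : ℕ) : Cardinal) ≤
    Module.rank ℝ (⨆ β ∈ Iic a, dirichletEigenspace U β : Submodule ℝ (H01 U))}

/-- The signature of a symmetric matrix: the number of positive eigenvalues minus the number of
negative eigenvalues, counted with multiplicity. -/
def sgn {p : ℕ} (M : Matrix (Fin p) (Fin p) ℝ) : ℤ :=
  (M.charpoly.roots.countP (fun μ => 0 < μ) : ℤ) - (M.charpoly.roots.countP (fun μ => μ < 0) : ℤ)

/-- The `k`-th term `sgn(-A - α_k⁻¹ B) - sgn(-A)`. -/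
def indexTerm [NeZero N] (U : BoundedOpen N) {p : ℕ} (A B : Matrix (Fin p) (Fin p) ℝ) (k : ℕ) :
    ℤ :=
  sgn (-A - (1 / dirichletEigenvalue U k) • B) - sgn (-A)

/-- `i(B) = ½ ∑_k (sgn(-A - α_k⁻¹ B) - sgn(-A))`; meaningful if only finitely many terms are
non-zero. -/
def index [NeZero N] (U : BoundedOpen N) {p : ℕ} (A B : Matrix (Fin p) (Fin p) ℝ) : ℝ :=
  (1 / 2) * ((∑ᶠ k, indexTerm U A B k : ℤ) : ℝ)

/-! ### The spectral flow -/

section SpectralFlow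

variable {X : Type*} [NormedAddCommGroup X] [InnerProductSpace ℝ X] [CompleteSpace X]

/-- `L` restricted to `[0,1]` is a continuous path of selfadjoint Fredholm operators with
invertible endpoints. -/
structure IsFredholmPath (L : ℝ → X →L[ℝ] X) : Prop where
  continuousOn : ContinuousOn L (Icc 0 1)
  selfAdjoint : ∀ s ∈ Icc (0 : ℝ) 1, IsSelfAdjoint (L s)
  closed_range : ∀ s ∈ Icc (0 : ℝ) 1, IsClosed (range (L s))
  finite_ker : ∀ s ∈ Icc (0 : ℝ) 1, FiniteDimensional ℝ (LinearMap.ker (L s : X →ₗ[ℝ] X))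
  isUnit_zero : IsUnit (L 0)
  isUnit_one : IsUnit (L 1)

/-- The sum of the eigenspaces of `S` for eigenvalues in `[0, a]`; this is the range of the spectral
projection `χ_[0,a](S)` if `S` is selfadjoint and `σ(S) ∩ [0, a]` is finite. -/
def spectralSpace (S : X →L[ℝ] X) (a : ℝ) : Submodule ℝ X :=
  ⨆ μ ∈ Icc 0 a, Module.End.eigenspace (S : X →ₗ[ℝ] X) μ

/-- The subdivisions `0 = t₀ ≤ ⋯ ≤ tₙ = 1` with numbers `aⱼ > 0` of Phillips' definition of the
spectral flow: for `s` in the `j`-th interval, `±aⱼ ∉ σ(L s)` and the part of `σ(L s)` in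
`[-aⱼ, aⱼ]` consists of finitely many eigenvalues of finite multiplicity. -/
structure SpectralSubdivision (L : ℝ → X →L[ℝ] X) where
  n : ℕ
  t : Fin (n + 1) → ℝ
  a : Fin n → ℝ
  mono : Monotone t
  t_zero : t 0 = 0
  t_last : t (Fin.last n) = 1
  a_pos : ∀ j, 0 < a j
  notMem_pos : ∀ j, ∀ s ∈ Icc (t j.castSucc) (t j.succ), a j ∉ spectrum ℝ (L s)
  notMem_neg : ∀ j, ∀ s ∈ Icc (t j.castSucc) (t j.succ), -a j ∉ spectrum ℝ (L s)
  finite_spectrum : ∀ j, ∀ s ∈ Icc (t j.castSucc) (t j.succ),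
    (spectrum ℝ (L s) ∩ Icc (-a j) (a j)).Finite
  finite_multiplicity : ∀ j, ∀ s ∈ Icc (t j.castSucc) (t j.succ), ∀ μ ∈ Icc (-a j) (a j),
    FiniteDimensional ℝ (Module.End.eigenspace (L s : X →ₗ[ℝ] X) μ)

/-- `∑ⱼ (dim χ_[0,aⱼ](L tⱼ₊₁) - dim χ_[0,aⱼ](L tⱼ))`. -/
def SpectralSubdivision.flow {L : ℝ → X →L[ℝ] X} (P : SpectralSubdivision L) : ℤ :=
  ∑ j : Fin P.n,
    ((Module.finrank ℝ (spectralSpace (L (P.t j.succ)) (P.a j)) : ℤ) -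
      (Module.finrank ℝ (spectralSpace (L (P.t j.castSucc)) (P.a j)) : ℤ))

open Classical in
/-- The spectral flow of the path `L` over `[0,1]`. -/
def spectralFlow (L : ℝ → X →L[ℝ] X) : ℤ :=
  if h : Nonempty (SpectralSubdivision L) then h.some.flow else 0

/-- The spectral flow of `L` is well defined: there is a subdivision as above, and the sum does not
depend on the subdivision. -/
def SpectralFlowWellDefined (L : ℝ → X →L[ℝ] X) : Prop :=
  Nonempty (SpectralSubdivision L) ∧ ∀ P : SpectralSubdivision L, P.flow = spectralFlow L

end SpectralFlow

end EllipticSF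

end

open EllipticSF

noncomputable section

namespace EllipticSF

/-! ### Operators diagonal in a Hilbert basis -/

section Diagonal

variable {X : Type*} [NormedAddCommGroup X] [InnerProductSpace ℝ X] {ι : Type*}

/-! The operator `massOp U` is compact (Rellich), symmetric and nonnegative, so `H¹₀(U)` has a
Hilbert basis `b i` with `massOp U (b i) = ν i • b i`. Since `B_λ` does not depend on `x`, each
subspace `ℝᵖ ⊗ b i` of `H` is invariant under every `L_λ`, which acts there as the symmetric matrix
`-A - ν i • B_λ` (`hessianOp_tensor`). The spectral flow is thereby reduced to counting eigenvalues
of matrices.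

As `A` is an isometry, the eigenvalues of such a block have modulus at least `1 - ν i * ‖B_λ‖`
(`le_abs_eigenvalues_pencil`), and only finitely many `ν i` exceed a given positive number. So for
`a < 1` only finitely many eigenvalues of `L_λ` lie in `[-a, a]`. This yields the Fredholm property,
the existence of subdivisions and, through stability of the signature, the finiteness of the index
series.

Along one interval of a subdivision `a_j` is never an eigenvalue of a block, so the number of
eigenvalues above `a_j` is constant in each block, and the change of the count in `[0, a_j]` is the
change of the count in `[0, ∞)` (`countP_Icc_sub_eq`). The latter does not involve `a_j`, hence the
sum over the intervals telescopes. At an invertible endpoint the number of nonnegative eigenvalues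
of a block is `(sgn + p) / 2`. The outcome, `two_mul_flow`, holds for every subdivision, so
independence of the choices comes with it.

Finally the sum over `ν i` has to become a sum over `1 / α_k`. Both families have the same counting
function at positive levels (`le_one_div_dirichletEigenvalue_iff`), and a sum whose terms vanish
near `0` depends on nothing else. -/

theorem inner_apply_of_diagonal {b : HilbertBasis ι ℝ X} {T : X →L[ℝ] X}
    {ν : ι → ℝ} (hT : ∀ i, T (b i) = ν i • b i) (i : ι) (x : X) :
    inner ℝ (b i) (T x) = ν i * inner ℝ (b i) x := by
  have h : (innerSL ℝ (b i)) ∘L T = ν i • innerSL ℝ (b i) := by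
    refine ContinuousLinearMap.ext_on (s := Set.range b)
      (Submodule.dense_iff_topologicalClosure_eq_top.2 b.dense_span) ?_
    rintro _ ⟨j, rfl⟩
    simp only [ContinuousLinearMap.comp_apply, hT, map_smul, innerSL_apply_apply,
      smul_apply, smul_eq_mul]
    rcases eq_or_ne i j with rfl | hij
    · rfl
    · simp [b.orthonormal.2 hij]
  simpa using DFunLike.congr_fun h x

theorem hilbertBasis_ext {b : HilbertBasis ι ℝ X} {x y : X}
    (h : ∀ i, inner ℝ (b i) x = inner ℝ (b i) y) : x = y := by
  apply b.repr.injective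
  ext i
  simp only [b.repr_apply_apply, h]

theorem hasSum_sq_inner (b : HilbertBasis ι ℝ X) (x : X) :
    HasSum (fun i => (inner ℝ (b i) x) ^ 2) (‖x‖ ^ 2) := by
  have := b.hasSum_inner_mul_inner x x
  rw [real_inner_self_eq_norm_sq] at this
  refine this.congr_fun fun i => ?_
  rw [real_inner_comm x, sq]

theorem isSelfAdjoint_of_diagonal [CompleteSpace X] {b : HilbertBasis ι ℝ X} {T : X →L[ℝ] X}
    {ν : ι → ℝ} (hT : ∀ i, T (b i) = ν i • b i) : IsSelfAdjoint T := by
  rw [ContinuousLinearMap.isSelfAdjoint_iff_isSymmetric]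
  intro x y
  have h1 := b.hasSum_inner_mul_inner (T x) y
  have h2 := b.hasSum_inner_mul_inner x (T y)
  refine h1.unique (h2.congr_fun fun i => ?_)
  rw [inner_apply_of_diagonal hT, real_inner_comm, inner_apply_of_diagonal hT, real_inner_comm x]
  ring

/-- Parseval, coefficient by coefficient. The bound on `ν i` is required only where `x` has a
component, so that it can also be applied on the orthogonal complement of the kernel. -/
theorem norm_le_of_diagonal {b : HilbertBasis ι ℝ X} {T : X →L[ℝ] X}
    {ν : ι → ℝ} (hT : ∀ i, T (b i) = ν i • b i) {c : ℝ} (hc : 0 ≤ c) {x : X}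
    (h : ∀ i, inner ℝ (b i) x ≠ 0 → c ≤ |ν i|) : c * ‖x‖ ≤ ‖T x‖ := by
  have h1 := (hasSum_sq_inner b x).mul_left (c ^ 2)
  have h2 := hasSum_sq_inner b (T x)
  refine le_of_sq_le_sq ?_ (norm_nonneg _)
  rw [mul_pow]
  refine hasSum_le (fun i => ?_) h1 h2
  rw [inner_apply_of_diagonal hT, mul_pow]
  by_cases hx : inner ℝ (b i) x = 0
  · simp [hx]
  · refine mul_le_mul_of_nonneg_right ?_ (sq_nonneg _)
    rw [← sq_abs (ν i)]
    exact pow_le_pow_left₀ hc (h i hx) 2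

/-- The operator is bounded below, and its range is dense because a vector orthogonal to all `ν i •
b i` with `ν i ≠ 0` has no coefficients. -/
theorem isUnit_of_diagonal [CompleteSpace X] {b : HilbertBasis ι ℝ X} {T : X →L[ℝ] X}
    {ν : ι → ℝ} (hT : ∀ i, T (b i) = ν i • b i) {c : ℝ} (hc : 0 < c) (h : ∀ i, c ≤ |ν i|) :
    IsUnit T := by
  rw [ContinuousLinearMap.isUnit_iff_bijective,
    ContinuousLinearMap.bijective_iff_dense_range_and_antilipschitz]
  constructor
  · rw [← Submodule.orthogonal_eq_bot_iff (K := T.range.topologicalClosure),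
      Submodule.orthogonal_closure, eq_bot_iff]
    intro y hy
    rw [Submodule.mem_bot]
    refine hilbertBasis_ext (b := b) fun i => ?_
    have h1 : inner ℝ (T (b i)) y = 0 := hy _ ⟨b i, rfl⟩
    rw [hT, real_inner_smul_left] at h1
    rcases mul_eq_zero.1 h1 with h2 | h2
    · have := h i
      rw [h2, abs_zero] at this
      linarith
    · rw [h2, inner_zero_right]
  · refine ⟨NNReal.mk c⁻¹ (by positivity), T.antilipschitz_of_bound fun x => ?_⟩
    have := norm_le_of_diagonal hT hc.le (x := x) fun i _ => h i
    rw [NNReal.coe_mk, ← div_eq_inv_mul, le_div_iff₀ hc]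
    linarith

theorem notMem_spectrum_of_diagonal [CompleteSpace X] {b : HilbertBasis ι ℝ X} {T : X →L[ℝ] X}
    {ν : ι → ℝ} (hT : ∀ i, T (b i) = ν i • b i) {μ c : ℝ} (hc : 0 < c) (h : ∀ i, c ≤ |μ - ν i|) :
    μ ∉ spectrum ℝ T := by
  rw [spectrum.notMem_iff]
  refine isUnit_of_diagonal (b := b) (ν := fun i => μ - ν i) (fun i => ?_) hc h
  rw [sub_apply, hT, Algebra.algebraMap_eq_smul_one,
    smul_apply, one_apply_eq_self, sub_smul]

theorem mem_spectrum_of_diagonal [CompleteSpace X] {b : HilbertBasis ι ℝ X} {T : X →L[ℝ] X}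
    {ν : ι → ℝ} (hT : ∀ i, T (b i) = ν i • b i) (i : ι) : ν i ∈ spectrum ℝ T := by
  rw [spectrum.mem_iff]
  intro h
  rw [ContinuousLinearMap.isUnit_iff_bijective] at h
  have h1 : b i = 0 := h.1 (by
    rw [sub_apply, hT, Algebra.algebraMap_eq_smul_one,
      smul_apply, one_apply_eq_self, sub_self, map_zero])
  exact b.orthonormal.ne_zero i h1

/-- A finite set of values has positive distance to any point outside it. -/
theorem exists_pos_le_abs_sub {ν : ι → ℝ} {a μ : ℝ} (hμa : |μ| < a)
    (hfin : {i | |ν i| ≤ a}.Finite) : ∃ c > 0, ∀ i, ν i ≠ μ → c ≤ |μ - ν i| := by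
  obtain ⟨c, hc0, hc⟩ : ∃ c > 0, ∀ i ∈ {i | |ν i| ≤ a}, ν i ≠ μ → c ≤ |μ - ν i| := by
    -- Deleting the distance `0` discards exactly the indices with `ν i = μ`; the remaining finite
    -- set of positive distances has a least element.
    have hf : (((fun i => |μ - ν i|) '' {i | |ν i| ≤ a}) \ {0}).Finite :=
      (hfin.image _).subset sdiff_subset
    rcases (((fun i => |μ - ν i|) '' {i | |ν i| ≤ a}) \ {0}).eq_empty_or_nonempty with he | hne
    · refine ⟨1, one_pos, fun i hi hne => ?_⟩
      have : |μ - ν i| ∈ (∅ : Set ℝ) := by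
        rw [← he]
        exact ⟨⟨i, hi, rfl⟩, by simpa [sub_eq_zero] using fun h => hne h.symm⟩
      exact this.elim
    · obtain ⟨c, hc, hmin⟩ := hf.exists_minimal hne
      obtain ⟨⟨i, hi, rfl⟩, hi0⟩ := id hc
      refine ⟨|μ - ν i|, lt_of_le_of_ne (abs_nonneg _) fun h => hi0 h.symm, fun j hj hne => ?_⟩
      by_contra! hlt
      have := hmin (y := |μ - ν j|)
        ⟨⟨j, hj, rfl⟩, by simpa [sub_eq_zero] using fun h => hne h.symm⟩ hlt.le
      exact absurd hlt (not_lt.2 this)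
  -- Indices with `|ν i| > a` stay at distance at least `a - |μ|` from `μ`.
  refine ⟨min c (a - |μ|), lt_min hc0 (by linarith), fun i hi => ?_⟩
  by_cases h : |ν i| ≤ a
  · exact (min_le_left _ _).trans (hc i h hi)
  · refine (min_le_right _ _).trans ?_
    have := abs_sub_abs_le_abs_sub (ν i) μ
    rw [abs_sub_comm] at this
    push Not at h
    linarith

theorem mem_eigenspace_of_diagonal {b : HilbertBasis ι ℝ X} {T : X →L[ℝ] X}
    {ν : ι → ℝ} (hT : ∀ i, T (b i) = ν i • b i) {μ : ℝ} {x : X} :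
    x ∈ Module.End.eigenspace (T : X →ₗ[ℝ] X) μ ↔ ∀ i, ν i ≠ μ → inner ℝ (b i) x = 0 := by
  rw [Module.End.mem_eigenspace_iff, ContinuousLinearMap.coe_coe]
  constructor
  · intro h i hi
    have h1 := inner_apply_of_diagonal hT i x
    rw [h, real_inner_smul_right] at h1
    have h2 : (ν i - μ) * inner ℝ (b i) x = 0 := by linarith
    exact (mul_eq_zero.1 h2).resolve_left (sub_ne_zero.2 hi)
  · intro h
    refine hilbertBasis_ext (b := b) fun i => ?_
    rw [inner_apply_of_diagonal hT, real_inner_smul_right]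
    by_cases hi : ν i = μ
    · rw [hi]
    · rw [h i hi, mul_zero, mul_zero]

theorem mem_span_of_inner_eq_zero {b : HilbertBasis ι ℝ X} {s : Set ι} (hs : s.Finite) {x : X}
    (h : ∀ i ∉ s, inner ℝ (b i) x = 0) : x ∈ Submodule.span ℝ (b '' s) := by
  have hx : x = ∑ i ∈ hs.toFinset, inner ℝ (b i) x • b i := by
    have h1 := b.hasSum_repr x
    refine h1.unique ?_
    simp_rw [b.repr_apply_apply]
    refine hasSum_sum_of_ne_finset_zero fun i hi => ?_
    rw [h i (by simpa using hi), zero_smul]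
  rw [hx]
  exact Submodule.sum_mem _ fun i hi =>
    Submodule.smul_mem _ _ (Submodule.subset_span ⟨i, by simpa using hi, rfl⟩)

theorem basis_mem_iSup_eigenspace {b : HilbertBasis ι ℝ X} {T : X →L[ℝ] X}
    {ν : ι → ℝ} (hT : ∀ i, T (b i) = ν i • b i) {W : Set ℝ} {i : ι} (hi : ν i ∈ W) :
    b i ∈ ⨆ μ ∈ W, Module.End.eigenspace (T : X →ₗ[ℝ] X) μ :=
  Submodule.mem_iSup_of_mem (ν i) (Submodule.mem_iSup_of_mem hi
    (Module.End.mem_eigenspace_iff.2 (hT i)))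

/-- An eigenvector with eigenvalue in `W` has nonzero coefficients only at the finitely many indices
with `ν i ∈ W`, so no closure of the span is needed. -/
theorem iSup_eigenspace_eq_span {b : HilbertBasis ι ℝ X} {T : X →L[ℝ] X}
    {ν : ι → ℝ} (hT : ∀ i, T (b i) = ν i • b i) {W : Set ℝ} (hW : {i | ν i ∈ W}.Finite) :
    (⨆ μ ∈ W, Module.End.eigenspace (T : X →ₗ[ℝ] X) μ) =
      Submodule.span ℝ (b '' {i | ν i ∈ W}) := by
  apply le_antisymm
  · refine iSup₂_le fun μ hμ x hx => mem_span_of_inner_eq_zero hW fun i hi => ?_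
    exact (mem_eigenspace_of_diagonal hT).1 hx i fun h => hi (by simpa [h] using hμ)
  · rw [Submodule.span_le]
    rintro _ ⟨i, hi, rfl⟩
    exact basis_mem_iSup_eigenspace hT hi

theorem rank_span_hilbertBasis (b : HilbertBasis ι ℝ X) {s : Set ι} (hs : s.Finite) :
    Module.rank ℝ (Submodule.span ℝ (b '' s)) = (s.ncard : Cardinal) := by
  have hli := b.orthonormal.linearIndependent
  rw [rank_span_set (hli.linearIndepOn s).id_image, ← Set.ncard_image_of_injective s hli.injective,
    ← Set.cast_ncard (hs.image b)]

theorem finrank_iSup_eigenspace {b : HilbertBasis ι ℝ X} {T : X →L[ℝ] X}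
    {ν : ι → ℝ} (hT : ∀ i, T (b i) = ν i • b i) {W : Set ℝ} (hW : {i | ν i ∈ W}.Finite) :
    Module.finrank ℝ (⨆ μ ∈ W, Module.End.eigenspace (T : X →ₗ[ℝ] X) μ : Submodule ℝ X) =
      {i | ν i ∈ W}.ncard := by
  rw [iSup_eigenspace_eq_span hT hW]
  exact Module.finrank_eq_of_rank_eq (rank_span_hilbertBasis b hW)

/-- Finitely many eigenvalues of finite multiplicity in `W` give finitely many basis vectors. -/
theorem finite_of_finite_eigenspace [CompleteSpace X] {b : HilbertBasis ι ℝ X} {T : X →L[ℝ] X}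
    {ν : ι → ℝ} (hT : ∀ i, T (b i) = ν i • b i) {W : Set ℝ} (h1 : (spectrum ℝ T ∩ W).Finite)
    (h2 : ∀ μ ∈ W, FiniteDimensional ℝ (Module.End.eigenspace (T : X →ₗ[ℝ] X) μ)) :
    {i | ν i ∈ W}.Finite := by
  have h3 : ∀ μ ∈ W, {i | ν i = μ}.Finite := by
    intro μ hμ
    have := h2 μ hμ
    have hli : LinearIndependent ℝ (fun i : {i | ν i = μ} =>
        (⟨b i, Module.End.mem_eigenspace_iff.2 (by
          rw [ContinuousLinearMap.coe_coe, hT, i.2.out])⟩ :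
            Module.End.eigenspace (T : X →ₗ[ℝ] X) μ)) := by
      refine LinearIndependent.of_comp (Submodule.subtype _) ?_
      exact b.orthonormal.linearIndependent.comp _ Subtype.val_injective
    have := hli.finite_of_isNoetherian
    exact Set.toFinite _
  refine (h1.biUnion (t := fun μ => {i | ν i = μ}) fun μ hμ => h3 μ hμ.2).subset fun i hi => ?_
  simp only [mem_iUnion]
  exact ⟨ν i, ⟨mem_spectrum_of_diagonal hT i, hi⟩, rfl⟩

theorem finiteDimensional_eigenspace {b : HilbertBasis ι ℝ X} {T : X →L[ℝ] X}
    {ν : ι → ℝ} (hT : ∀ i, T (b i) = ν i • b i) {μ : ℝ} (h : {i | ν i = μ}.Finite) :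
    FiniteDimensional ℝ (Module.End.eigenspace (T : X →ₗ[ℝ] X) μ) := by
  have h1 := iSup_eigenspace_eq_span hT (W := {μ}) h
  simp only [mem_singleton_iff, iSup_iSup_eq_left] at h1
  rw [h1]
  exact FiniteDimensional.span_of_finite ℝ (h.image b)

/-- The restriction of `T` to the orthogonal complement of its kernel has the same range, and it is
bounded below since only indices with `ν i ≠ 0` occur there. -/
theorem isClosed_range_of_diagonal [CompleteSpace X] {b : HilbertBasis ι ℝ X} {T : X →L[ℝ] X}
    {ν : ι → ℝ} (hT : ∀ i, T (b i) = ν i • b i) {c : ℝ} (hc : 0 < c)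
    (h : ∀ i, ν i ≠ 0 → c ≤ |ν i|) : IsClosed (range T) := by
  set V : Submodule ℝ X := (LinearMap.ker (T : X →ₗ[ℝ] X))ᗮ with hV
  have hcl : IsClosed ((LinearMap.ker (T : X →ₗ[ℝ] X)) : Set X) := T.isClosed_ker
  have hcs : CompleteSpace (LinearMap.ker (T : X →ₗ[ℝ] X)) := hcl.completeSpace_coe
  have h1 : range T = range (T ∘L V.subtypeL) := by
    apply subset_antisymm
    · rintro _ ⟨x, rfl⟩
      obtain ⟨y, hy, z, hz, rfl⟩ :=
        (LinearMap.ker (T : X →ₗ[ℝ] X)).exists_add_mem_mem_orthogonal x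
      refine ⟨⟨z, hz⟩, ?_⟩
      have : T y = 0 := hy
      simp [this]
    · rintro _ ⟨x, rfl⟩
      exact ⟨x, rfl⟩
  rw [h1]
  have h2 : AntilipschitzWith (NNReal.mk c⁻¹ (by positivity)) (T ∘L V.subtypeL) := by
    refine ContinuousLinearMap.antilipschitz_of_bound _ fun x => ?_
    have := norm_le_of_diagonal hT hc.le (x := (x : X)) fun i hi => h i fun h0 => hi ?_
    · rw [NNReal.coe_mk, ← div_eq_inv_mul, le_div_iff₀ hc]
      simpa [mul_comm] using this
    · exact x.2 (b i) (by
        rw [LinearMap.mem_ker, ContinuousLinearMap.coe_coe, hT, h0, zero_smul])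
  exact h2.isClosed_range (T ∘L V.subtypeL).uniformContinuous

end Diagonal

/-! ### Stability of the inertia of symmetric matrices -/

section Inertia

variable {X : Type*} [NormedAddCommGroup X] [InnerProductSpace ℝ X] {ι : Type*}

theorem hasSum_inner_of_diagonal {b : HilbertBasis ι ℝ X} {T : X →L[ℝ] X}
    {ν : ι → ℝ} (hT : ∀ i, T (b i) = ν i • b i) (x : X) :
    HasSum (fun i => ν i * (inner ℝ (b i) x) ^ 2) (inner ℝ x (T x)) := by
  refine (b.hasSum_inner_mul_inner x (T x)).congr_fun fun i => ?_
  rw [inner_apply_of_diagonal hT, real_inner_comm]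
  ring

theorem inner_eq_zero_of_mem_span {b : HilbertBasis ι ℝ X} {s : Set ι} {x : X}
    (hx : x ∈ Submodule.span ℝ (b '' s)) {i : ι} (hi : i ∉ s) : inner ℝ (b i) x = 0 := by
  have : Submodule.span ℝ (b '' s) ≤ LinearMap.ker (innerSL ℝ (b i) : X →ₗ[ℝ] ℝ) := by
    rw [Submodule.span_le]
    rintro _ ⟨j, hj, rfl⟩
    have hij : i ≠ j := fun h => hi (h ▸ hj)
    simpa using b.orthonormal.2 hij
  simpa using this hx

/-- If the eigenvalues of `T` have absolute value at least `c` and `‖T' - T‖ < c`, then `T'` has at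
least as many positive eigenvalues as `T`. -/
theorem ncard_pos_le_of_norm_sub_lt [Finite ι] {b b' : HilbertBasis ι ℝ X} {T T' : X →L[ℝ] X}
    {ν ν' : ι → ℝ} (hT : ∀ i, T (b i) = ν i • b i) (hT' : ∀ i, T' (b' i) = ν' i • b' i) {c : ℝ}
    (hc : ∀ i, c ≤ |ν i|) (h : ‖T' - T‖ < c) :
    {i | 0 < ν i}.ncard ≤ {i | 0 < ν' i}.ncard := by
  have hfd : FiniteDimensional ℝ X := by
    have := Fintype.ofFinite ι
    exact b.toOrthonormalBasis.toBasis.finiteDimensional_of_finite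
  have hdim : Module.finrank ℝ X = Nat.card ι := by
    have := Fintype.ofFinite ι
    rw [Module.finrank_eq_card_basis b.toOrthonormalBasis.toBasis, Nat.card_eq_fintype_card]
  -- On the first span the quadratic form of `T` is at least `c * ‖x‖ ^ 2`, on the second that of
  -- `T'` is at most `0`. The forms differ by less than `c * ‖x‖ ^ 2` for `x ≠ 0`, so the spans meet
  -- only in `0` and their dimensions add up to at most `dim X`.
  have h1 : Disjoint (Submodule.span ℝ (b '' {i | 0 < ν i}))
      (Submodule.span ℝ (b' '' {i | 0 < ν' i}ᶜ)) := by
    rw [Submodule.disjoint_def]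
    intro x hx hx'
    have e1 : c * ‖x‖ ^ 2 ≤ inner ℝ x (T x) := by
      refine hasSum_le (fun i => ?_) ((hasSum_sq_inner b x).mul_left c)
        (hasSum_inner_of_diagonal hT x)
      by_cases hi : 0 < ν i
      · have := hc i
        rw [abs_of_pos hi] at this
        exact mul_le_mul_of_nonneg_right this (sq_nonneg _)
      · rw [inner_eq_zero_of_mem_span hx hi]
        simp
    have e2 : inner ℝ x (T' x) ≤ 0 := by
      refine hasSum_le (fun i => ?_) (hasSum_inner_of_diagonal hT' x) hasSum_zero
      by_cases hi : 0 < ν' i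
      · rw [inner_eq_zero_of_mem_span hx' (by simpa using hi)]
        simp
      · exact mul_nonpos_of_nonpos_of_nonneg (not_lt.1 hi) (sq_nonneg _)
    have e3 : |inner ℝ x ((T' - T) x)| ≤ ‖T' - T‖ * ‖x‖ ^ 2 := by
      refine (abs_real_inner_le_norm _ _).trans ?_
      have := (T' - T).le_opNorm x
      nlinarith [norm_nonneg x]
    rw [sub_apply, inner_sub_right] at e3
    have e4 := (abs_le.1 e3).1
    have e5 : (c - ‖T' - T‖) * ‖x‖ ^ 2 ≤ 0 := by linarith
    have e6 : ‖x‖ ^ 2 ≤ 0 := by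
      by_contra! hlt
      nlinarith
    exact norm_eq_zero.1 (pow_eq_zero_iff two_ne_zero |>.1 (le_antisymm e6 (sq_nonneg _)))
  have h2 := Submodule.finrank_add_finrank_le_of_disjoint h1
  rw [Module.finrank_eq_of_rank_eq (rank_span_hilbertBasis b (Set.toFinite _)),
    Module.finrank_eq_of_rank_eq (rank_span_hilbertBasis b' (Set.toFinite _)), hdim,
    ← Set.ncard_add_ncard_compl {i | 0 < ν' i}] at h2
  omega

/-- Neither the number of eigenvalues above `a` nor the number below `a` can drop from `T` to `T'`.
For `T` the two already exhaust all indices, so neither can grow. -/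
theorem ncard_gt_eq_of_norm_sub_lt [Finite ι] {b b' : HilbertBasis ι ℝ X} {T T' : X →L[ℝ] X}
    {ν ν' : ι → ℝ} (hT : ∀ i, T (b i) = ν i • b i) (hT' : ∀ i, T' (b' i) = ν' i • b' i) {a c : ℝ}
    (hc : ∀ i, c ≤ |ν i - a|) (h : ‖T' - T‖ < c) :
    {i | a < ν i}.ncard = {i | a < ν' i}.ncard := by
  have hc0 : 0 < c := (norm_nonneg _).trans_lt h
  set I : X →L[ℝ] X := ContinuousLinearMap.id ℝ X
  have h1 := ncard_pos_le_of_norm_sub_lt (b := b) (b' := b') (T := T - a • I) (T' := T' - a • I)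
    (ν := fun i => ν i - a) (ν' := fun i => ν' i - a)
    (fun i => by simp [I, hT, sub_smul]) (fun i => by simp [I, hT', sub_smul]) hc
    (by rwa [sub_sub_sub_cancel_right])
  have h2 := ncard_pos_le_of_norm_sub_lt (b := b) (b' := b') (T := a • I - T) (T' := a • I - T')
    (ν := fun i => a - ν i) (ν' := fun i => a - ν' i)
    (fun i => by simp [I, hT, sub_smul]) (fun i => by simp [I, hT', sub_smul])
    (fun i => by rw [abs_sub_comm]; exact hc i) (by rwa [sub_sub_sub_cancel_left, norm_sub_rev])
  simp only [sub_pos] at h1 h2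
  refine le_antisymm h1 ?_
  have e1 := Set.ncard_add_ncard_compl {i | a < ν i}
  have e2 := Set.ncard_add_ncard_compl {i | a < ν' i}
  have e3 : {i | a < ν i}ᶜ = {i | ν i < a} := by
    ext i
    have : ν i ≠ a := fun h0 => by
      have := hc i
      rw [h0, sub_self, abs_zero] at this
      linarith
    simp only [mem_compl_iff, mem_ofPred_eq, not_lt]
    exact ⟨fun h => lt_of_le_of_ne h this, le_of_lt⟩
  have e4 : {i | ν' i < a} ⊆ {i | a < ν' i}ᶜ := fun i hi => by
    simp only [mem_compl_iff, mem_ofPred_eq, not_lt] at hi ⊢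
    exact hi.le
  have e5 := Set.ncard_le_ncard e4
  rw [e3] at e1
  omega

end Inertia

/-! ### Eigenvalue counts and signatures of real symmetric matrices. -/

section Matrix

variable {p : ℕ}

/-- The operator of a matrix on Euclidean space. -/
abbrev euclOp (M : Matrix (Fin p) (Fin p) ℝ) : E p →L[ℝ] E p := Matrix.toEuclideanCLM (𝕜 := ℝ) M

theorem continuous_euclOp : Continuous (euclOp (p := p)) := by
  have := LinearMap.continuous_of_finiteDimensional
    ((Matrix.toEuclideanCLM (n := Fin p) (𝕜 := ℝ)).toAlgEquiv.toLinearMap)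
  exact this

theorem euclOp_eigenvectorBasis {M : Matrix (Fin p) (Fin p) ℝ} (hM : M.IsHermitian) (i : Fin p) :
    euclOp M (hM.eigenvectorBasis.toHilbertBasis i) =
      hM.eigenvalues i • hM.eigenvectorBasis.toHilbertBasis i := by
  rw [OrthonormalBasis.coe_toHilbertBasis]
  have := hM.mulVec_eigenvectorBasis i
  ext j
  exact congrFun this j

theorem countP_roots_charpoly {M : Matrix (Fin p) (Fin p) ℝ} (hM : M.IsHermitian) (P : ℝ → Prop)
    [DecidablePred P] : M.charpoly.roots.countP P = {i | P (hM.eigenvalues i)}.ncard := by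
  rw [hM.roots_charpoly_eq_eigenvalues, Multiset.countP_map, Set.ncard_eq_toFinset_card']
  simp [Finset.card]

theorem exists_pos_le_abs_eigenvalues_sub {M : Matrix (Fin p) (Fin p) ℝ} (hM : M.IsHermitian)
    {a : ℝ} (ha : ∀ i, hM.eigenvalues i ≠ a) : ∃ c > 0, ∀ i, c ≤ |hM.eigenvalues i - a| := by
  obtain ⟨c, hc, h⟩ := exists_pos_le_abs_sub (ν := hM.eigenvalues) (μ := a) (a := |a| + 1)
    (by linarith) (Set.toFinite _)
  exact ⟨c, hc, fun i => by rw [abs_sub_comm]; exact h i (ha i)⟩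

theorem eigenvalues_mem_roots {M : Matrix (Fin p) (Fin p) ℝ} (hM : M.IsHermitian) (i : Fin p) :
    hM.eigenvalues i ∈ M.charpoly.roots := by
  rw [hM.roots_charpoly_eq_eigenvalues]
  exact Multiset.mem_map.2 ⟨i, Finset.mem_univ i, rfl⟩

theorem exists_eigenvalues_eq {M : Matrix (Fin p) (Fin p) ℝ} (hM : M.IsHermitian) {a : ℝ}
    (ha : a ∈ M.charpoly.roots) : ∃ i, hM.eigenvalues i = a := by
  rw [hM.roots_charpoly_eq_eigenvalues] at ha
  obtain ⟨i, -, hi⟩ := Multiset.mem_map.1 ha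
  exact ⟨i, hi⟩

/-- The number of eigenvalues above `a` is constant along a path of symmetric matrices none of which
has the eigenvalue `a`. -/
theorem countP_gt_const {M : ℝ → Matrix (Fin p) (Fin p) ℝ} {s : Set ℝ}
    (hs : IsPreconnected s) (hc : ContinuousOn M s) (hM : ∀ t ∈ s, (M t).IsHermitian) {a : ℝ}
    (ha : ∀ t ∈ s, a ∉ (M t).charpoly.roots) {t t' : ℝ} (ht : t ∈ s) (ht' : t' ∈ s) :
    (M t).charpoly.roots.countP (a < ·) = (M t').charpoly.roots.countP (a < ·) := by
  refine hs.constant (f := fun t => (M t).charpoly.roots.countP (a < ·)) ?_ ht ht'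
  intro t ht
  -- The gap `c` between `a` and the eigenvalues of `M t` is the radius within which the count is
  -- stable; the count is therefore locally constant on a preconnected set.
  obtain ⟨c, hc0, hca⟩ := exists_pos_le_abs_eigenvalues_sub (hM t ht)
    (a := a) fun i h => ha t ht (by rw [← h]; exact eigenvalues_mem_roots (hM t ht) i)
  have h1 : ContinuousWithinAt (fun u => ‖euclOp (M u) - euclOp (M t)‖) s t :=
    (((continuous_euclOp.comp_continuousOn hc) t ht).sub continuousWithinAt_const).norm
  have h2 : ∀ᶠ u in nhdsWithin t s, ‖euclOp (M u) - euclOp (M t)‖ < c :=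
    h1.eventually_lt_const (by simpa using hc0)
  refine (continuousWithinAt_const (b := (M t).charpoly.roots.countP (a < ·))).congr_of_eventuallyEq
    ?_ rfl
  filter_upwards [h2, self_mem_nhdsWithin] with u hu hus
  rw [countP_roots_charpoly (hM t ht), countP_roots_charpoly (hM u hus)]
  exact (ncard_gt_eq_of_norm_sub_lt (euclOp_eigenvectorBasis (hM t ht))
    (euclOp_eigenvectorBasis (hM u hus)) hca hu).symm

theorem card_roots_charpoly {M : Matrix (Fin p) (Fin p) ℝ} (hM : M.IsHermitian) :
    M.charpoly.roots.card = p := by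
  rw [hM.roots_charpoly_eq_eigenvalues]
  simp

/-- Links the index, a signature, with the spectral flow, which counts the eigenvalue `0` together
with the positive ones. -/
theorem sgn_eq_of_zero_notMem_roots {M : Matrix (Fin p) (Fin p) ℝ} (hM : M.IsHermitian)
    (h : 0 ∉ M.charpoly.roots) :
    sgn M = 2 * (M.charpoly.roots.countP (0 ≤ ·) : ℤ) - p := by
  have e1 := Multiset.card_eq_countP_add_countP (0 ≤ ·) M.charpoly.roots
  rw [card_roots_charpoly hM] at e1
  have e2 : M.charpoly.roots.countP (fun μ => ¬ 0 ≤ μ) = M.charpoly.roots.countP (· < 0) :=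
    Multiset.countP_congr rfl fun x _ => by simp
  have e3 : M.charpoly.roots.countP (0 < ·) = M.charpoly.roots.countP (0 ≤ ·) :=
    Multiset.countP_congr rfl fun x hx => by
      have : x ≠ 0 := fun h0 => h (h0 ▸ hx)
      exact propext ⟨le_of_lt, fun h' => lt_of_le_of_ne h' this.symm⟩
  rw [sgn, e3]
  omega

theorem countP_Icc_add_countP_gt (m : Multiset ℝ) {a : ℝ} (ha : 0 ≤ a) :
    m.countP (· ∈ Icc 0 a) + m.countP (a < ·) = m.countP (0 ≤ ·) := by
  induction m using Multiset.induction_on with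
  | empty => simp
  | cons x m ih =>
    simp only [Multiset.countP_cons, ← ih, mem_Icc]
    rcases le_or_gt x a with h | h
    · simp only [h, and_true, not_lt.2 h, if_false]
      omega
    · simp only [not_le.2 h, and_false, h, ha.trans h.le, if_true, if_false]
      omega

/-- Close to an invertible symmetric matrix the signature is constant. -/
theorem sgn_eq_of_norm_sub_lt {M M' : Matrix (Fin p) (Fin p) ℝ} (hM : M.IsHermitian)
    (hM' : M'.IsHermitian) {c : ℝ} (hc : ∀ i, c ≤ |hM.eigenvalues i|)
    (h : ‖euclOp M' - euclOp M‖ < c) : sgn M' = sgn M := by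
  have h1 := ncard_gt_eq_of_norm_sub_lt (a := 0) (euclOp_eigenvectorBasis hM)
    (euclOp_eigenvectorBasis hM') (by simpa using hc) h
  have h2 := ncard_gt_eq_of_norm_sub_lt (a := 0) (T := -euclOp M) (T' := -euclOp M')
    (ν := fun i => -hM.eigenvalues i) (ν' := fun i => -hM'.eigenvalues i)
    (b := hM.eigenvectorBasis.toHilbertBasis) (b' := hM'.eigenvectorBasis.toHilbertBasis)
    (fun i => by rw [neg_apply, euclOp_eigenvectorBasis, neg_smul])
    (fun i => by rw [neg_apply, euclOp_eigenvectorBasis, neg_smul])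
    (by simpa using hc) (by rwa [neg_sub_neg, norm_sub_rev])
  simp only [Left.neg_pos_iff] at h2
  rw [sgn, sgn, countP_roots_charpoly hM, countP_roots_charpoly hM, countP_roots_charpoly hM',
    countP_roots_charpoly hM', h1, h2]

end Matrix

/-! ### Compactness of the embedding `H¹₀(U) → L²(U)` -/

section Rellich

theorem sq_lintegral_le {α : Type*} [MeasurableSpace α] (μ : Measure α) {f : α → ENNReal}
    (hf : AEMeasurable f μ) : (∫⁻ x, f x ∂μ) ^ 2 ≤ μ univ * ∫⁻ x, f x ^ 2 ∂μ := by
  have h := ENNReal.lintegral_mul_le_Lp_mul_Lq μ (Real.HolderConjugate.two_two) hf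
    (aemeasurable_const (b := (1 : ENNReal)))
  simp only [Pi.mul_apply, mul_one, ENNReal.rpow_two, one_pow, lintegral_one] at h
  calc (∫⁻ x, f x ∂μ) ^ 2 ≤ ((∫⁻ x, f x ^ 2 ∂μ) ^ (1 / 2 : ℝ) * μ univ ^ (1 / 2 : ℝ)) ^ 2 :=
        pow_le_pow_left' h 2
    _ = μ univ * ∫⁻ x, f x ^ 2 ∂μ := by
        rw [mul_pow, ← ENNReal.rpow_natCast, ← ENNReal.rpow_natCast, ← ENNReal.rpow_mul,
          ← ENNReal.rpow_mul]
        norm_num [mul_comm]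

variable {N : ℕ}

/-- The fundamental theorem of calculus along the segment from `x` to `x + z`, followed by
Cauchy–Schwarz on the unit interval. -/
theorem enorm_sub_sq_le {φ : E N → ℝ} (hφ : ContDiff ℝ ∞ φ) (x z : E N) :
    ‖φ (x + z) - φ x‖ₑ ^ 2 ≤
      ‖z‖ₑ ^ 2 * ∫⁻ t in Ioc (0 : ℝ) 1, ‖gradient φ (x + t • z)‖ₑ ^ 2 := by
  have hd : Differentiable ℝ φ := hφ.differentiable (by simp)
  have hdc : Continuous (fderiv ℝ φ) := hφ.continuous_fderiv (by simp)
  have hc : Continuous (fun t : ℝ => fderiv ℝ φ (x + t • z) z) :=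
    (hdc.comp (by fun_prop)).clm_apply continuous_const
  have h1 : φ (x + z) - φ x = ∫ t in (0 : ℝ)..1, fderiv ℝ φ (x + t • z) z := by
    have := intervalIntegral.integral_eq_sub_of_hasDerivAt (a := 0) (b := 1)
      (f := fun t : ℝ => φ (x + t • z)) (f' := fun t => fderiv ℝ φ (x + t • z) z)
      (fun t _ => by
        have h2 : HasDerivAt (fun t : ℝ => x + t • z) z t := by
          simpa using ((hasDerivAt_id t).smul_const z).const_add x
        exact (hd _).hasFDerivAt.comp_hasDerivAt t h2) (hc.intervalIntegrable _ _)
    rw [this]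
    simp
  rw [h1, intervalIntegral.integral_of_le zero_le_one]
  have h3 : ‖∫ t in Ioc (0 : ℝ) 1, fderiv ℝ φ (x + t • z) z‖ₑ ≤
      ∫⁻ t in Ioc (0 : ℝ) 1, ‖gradient φ (x + t • z)‖ₑ * ‖z‖ₑ := by
    refine (enorm_integral_le_lintegral_enorm _).trans (lintegral_mono fun t => ?_)
    have h4 : ‖gradient φ (x + t • z)‖ₑ = ‖fderiv ℝ φ (x + t • z)‖ₑ := by
      simp [gradient, enorm_eq_nnnorm]
    rw [h4]
    exact ContinuousLinearMap.le_opENorm _ _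
  have hg : Measurable fun t : ℝ => ‖gradient φ (x + t • z)‖ₑ :=
    (((InnerProductSpace.toDual ℝ (E N)).symm.continuous.comp
      (hdc.comp (by fun_prop : Continuous fun t : ℝ => x + t • z))).enorm).measurable
  rw [lintegral_mul_const _ hg] at h3
  refine (pow_le_pow_left' h3 2).trans ?_
  rw [mul_pow, mul_comm]
  gcongr
  refine (sq_lintegral_le _ hg.aemeasurable).trans ?_
  simp

/-- Integration of the pointwise bound over `x`, Tonelli, and translation invariance of Lebesgue
measure. -/
theorem lintegral_enorm_translate_sub_sq_le {φ : E N → ℝ} (hφ : ContDiff ℝ ∞ φ) (z : E N) :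
    ∫⁻ x, ‖φ (x + z) - φ x‖ₑ ^ 2 ≤ ‖z‖ₑ ^ 2 * ∫⁻ x, ‖gradient φ x‖ₑ ^ 2 := by
  have hg : Continuous (gradient φ) :=
    (InnerProductSpace.toDual ℝ (E N)).symm.continuous.comp (hφ.continuous_fderiv (by simp))
  have hm : Measurable fun q : E N × ℝ => ‖gradient φ (q.1 + q.2 • z)‖ₑ ^ 2 :=
    ((hg.comp (by fun_prop : Continuous fun q : E N × ℝ => q.1 + q.2 • z)).enorm.measurable
      ).pow_const 2
  calc ∫⁻ x, ‖φ (x + z) - φ x‖ₑ ^ 2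
      ≤ ∫⁻ x, ‖z‖ₑ ^ 2 * ∫⁻ t in Ioc (0 : ℝ) 1, ‖gradient φ (x + t • z)‖ₑ ^ 2 :=
        lintegral_mono fun x => enorm_sub_sq_le hφ x z
    _ = ‖z‖ₑ ^ 2 * ∫⁻ x, ∫⁻ t in Ioc (0 : ℝ) 1, ‖gradient φ (x + t • z)‖ₑ ^ 2 :=
        lintegral_const_mul _ hm.lintegral_prod_right'
    _ = ‖z‖ₑ ^ 2 * ∫⁻ t in Ioc (0 : ℝ) 1, ∫⁻ x, ‖gradient φ (x + t • z)‖ₑ ^ 2 := by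
        rw [lintegral_lintegral_swap hm.aemeasurable]
    _ = ‖z‖ₑ ^ 2 * ∫⁻ x, ‖gradient φ x‖ₑ ^ 2 := by
        congr 1
        simp_rw [fun t : ℝ => lintegral_add_right_eq_self (μ := (volume : Measure (E N)))
          (fun x => ‖gradient φ x‖ₑ ^ 2) (t • z)]
        simp

/-- The half-open cube of side `h` with lower corner `h • k`. -/
def cube (h : ℝ) (k : Fin N → ℤ) : Set (E N) := {x | ∀ i, ⌊x i / h⌋ = k i}

theorem cube_eq_preimage {h : ℝ} (hh : 0 < h) (k : Fin N → ℤ) :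
    cube h k = WithLp.ofLp ⁻¹' (Set.pi univ fun i => Ico (h * k i) (h * k i + h)) := by
  ext x
  simp only [cube, mem_ofPred_eq, mem_preimage, Set.mem_pi, mem_univ, true_imp_iff,
    Int.floor_eq_iff, mem_Ico, le_div_iff₀ hh, div_lt_iff₀ hh, add_mul, one_mul, mul_comm h]

theorem measurableSet_cube {h : ℝ} (hh : 0 < h) (k : Fin N → ℤ) :
    MeasurableSet (cube (N := N) h k) := by
  rw [cube_eq_preimage hh]
  exact (PiLp.volume_preserving_ofLp (Fin N)).measurable
    (MeasurableSet.univ_pi fun i => measurableSet_Ico)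

theorem volume_cube {h : ℝ} (hh : 0 < h) (k : Fin N → ℤ) :
    volume (cube (N := N) h k) = ENNReal.ofReal h ^ N := by
  rw [cube_eq_preimage hh, (PiLp.volume_preserving_ofLp (Fin N)).measure_preimage
    (MeasurableSet.univ_pi fun i => measurableSet_Ico).nullMeasurableSet, Real.volume_pi_Ico]
  simp

/-- The closed cube of side `2h` centred at the origin. -/
def centredCube (N : ℕ) (h : ℝ) : Set (E N) := {z | ∀ i, |z i| ≤ h}

theorem centredCube_eq_preimage (h : ℝ) :
    centredCube N h = WithLp.ofLp ⁻¹' (Set.pi univ fun _ => Icc (-h) h) := by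
  ext x
  simp [centredCube, abs_le, Pi.le_def, forall_and]

theorem measurableSet_centredCube (h : ℝ) : MeasurableSet (centredCube N h) := by
  rw [centredCube_eq_preimage]
  exact (PiLp.volume_preserving_ofLp (Fin N)).measurable
    (MeasurableSet.univ_pi fun i => measurableSet_Icc)

theorem volume_centredCube (h : ℝ) :
    volume (centredCube N h) = ENNReal.ofReal (2 * h) ^ N := by
  rw [centredCube_eq_preimage, (PiLp.volume_preserving_ofLp (Fin N)).measure_preimage
    (MeasurableSet.univ_pi fun i => measurableSet_Icc).nullMeasurableSet,
    volume_pi, Measure.pi_pi]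
  simp [two_mul]

theorem norm_le_of_mem_centredCube {h : ℝ} {z : E N} (hz : z ∈ centredCube N h) :
    ‖z‖ₑ ^ 2 ≤ ENNReal.ofReal (N * h ^ 2) := by
  have h1 : ‖z‖ ^ 2 ≤ N * h ^ 2 := by
    rw [EuclideanSpace.norm_sq_eq]
    calc ∑ i, ‖z i‖ ^ 2 ≤ ∑ _i : Fin N, h ^ 2 :=
          Finset.sum_le_sum fun i _ => pow_le_pow_left₀ (norm_nonneg _) (hz i) 2
      _ = N * h ^ 2 := by simp
  rw [← ofReal_norm, ← ENNReal.ofReal_pow (norm_nonneg _)]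
  exact ENNReal.ofReal_le_ofReal h1

theorem sub_mem_centredCube {h : ℝ} (hh : 0 < h) {k : Fin N → ℤ} {x y : E N} (hx : x ∈ cube h k)
    (hy : y ∈ cube h k) : y - x ∈ centredCube N h := by
  intro i
  have h1 := Int.abs_sub_lt_one_of_floor_eq_floor ((hy i).trans (hx i).symm)
  rw [← sub_div, abs_div, abs_of_pos hh, div_lt_one hh] at h1
  simpa using h1.le

/-- The mean of `φ` over a cube. -/
def cubeMean (h : ℝ) (φ : E N → ℝ) (k : Fin N → ℤ) : ℝ := (h ^ N)⁻¹ * ∫ y in cube h k, φ y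

/-- Cauchy–Schwarz on the cube, then the substitution `y = x + z`. The domain of `z` is enlarged to
a set that depends neither on `k` nor on `x`, which allows the integrals over `x` and `z` to be
exchanged afterwards. -/
theorem enorm_sub_cubeMean_sq_le {h : ℝ} (hh : 0 < h) {φ : E N → ℝ} (hφ : Continuous φ)
    (hφc : HasCompactSupport φ) {k : Fin N → ℤ} {x : E N} (hx : x ∈ cube h k) :
    ‖φ x - cubeMean h φ k‖ₑ ^ 2 ≤
      (ENNReal.ofReal h ^ N)⁻¹ * ∫⁻ z in centredCube N h, ‖φ (x + z) - φ x‖ₑ ^ 2 := by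
  have hhN : (0 : ℝ) < h ^ N := by positivity
  have hv : volume.real (cube (N := N) h k) = h ^ N := by
    rw [Measure.real, volume_cube hh, ENNReal.toReal_pow, ENNReal.toReal_ofReal hh.le]
  have hne : ENNReal.ofReal h ^ N ≠ 0 := pow_ne_zero _ (by simpa using hh)
  have hnt : ENNReal.ofReal h ^ N ≠ ⊤ := ENNReal.pow_ne_top ENNReal.ofReal_ne_top
  have hfin : volume (cube (N := N) h k) ≠ ⊤ := by rwa [volume_cube hh]
  have h1 : φ x - cubeMean h φ k = (h ^ N)⁻¹ * ∫ y in cube h k, (φ x - φ y) := by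
    rw [integral_sub (integrable_const_iff.2 (Or.inr ⟨by simpa using hfin.lt_top⟩))
      (hφ.integrable_of_hasCompactSupport hφc).integrableOn, setIntegral_const, hv, cubeMean,
      smul_eq_mul, mul_sub, inv_mul_cancel_left₀ hhN.ne']
  have h2 : ‖∫ y in cube h k, (φ x - φ y)‖ₑ ^ 2 ≤
      ENNReal.ofReal h ^ N * ∫⁻ z in centredCube N h, ‖φ (x + z) - φ x‖ₑ ^ 2 := by
    calc ‖∫ y in cube h k, (φ x - φ y)‖ₑ ^ 2
        ≤ (∫⁻ y in cube h k, ‖φ x - φ y‖ₑ) ^ 2 :=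
          pow_le_pow_left' (enorm_integral_le_lintegral_enorm _) 2
      _ ≤ ENNReal.ofReal h ^ N * ∫⁻ y in cube h k, ‖φ x - φ y‖ₑ ^ 2 := by
          refine (sq_lintegral_le _ ?_).trans_eq ?_
          · exact (continuous_const.sub hφ).enorm.measurable.aemeasurable
          · rw [Measure.restrict_apply_univ, volume_cube hh]
      _ ≤ _ := by
          refine mul_le_mul_right ?_ _
          rw [← lintegral_indicator (measurableSet_cube hh k),
            ← lintegral_indicator (measurableSet_centredCube h),
            ← lintegral_add_left_eq_self _ x]
          refine lintegral_mono fun z => ?_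
          by_cases hz : x + z ∈ cube h k
          swap
          · rw [Set.indicator_of_notMem hz]
            exact zero_le
          have hz' : z ∈ centredCube N h := by
            have := sub_mem_centredCube hh hx hz
            rwa [add_sub_cancel_left] at this
          rw [Set.indicator_of_mem hz, Set.indicator_of_mem hz', ← enorm_neg, neg_sub]
  have h3 : ‖(h ^ N)⁻¹‖ₑ = (ENNReal.ofReal h ^ N)⁻¹ := by
    rw [← ofReal_norm, Real.norm_of_nonneg (by positivity),
      ENNReal.ofReal_inv_of_pos hhN, ENNReal.ofReal_pow hh.le]
  rw [h1, enorm_mul, mul_pow, h3]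
  calc _ ≤ (ENNReal.ofReal h ^ N)⁻¹ ^ 2 * (ENNReal.ofReal h ^ N * _) := by gcongr
    _ = _ := by
      rw [sq, mul_assoc, ← mul_assoc (ENNReal.ofReal h ^ N)⁻¹ (ENNReal.ofReal h ^ N),
        ENNReal.inv_mul_cancel hne hnt, one_mul]

/-- Replacing a test function by its means over the cubes of side `h` costs `O(h)` in `L²`. -/
theorem lintegral_sub_cubeMean_sq_le {h : ℝ} (hh : 0 < h) {φ : E N → ℝ} (hφ : ContDiff ℝ ∞ φ)
    (hφc : HasCompactSupport φ) :
    ∫⁻ x, ‖φ x - cubeMean h φ (fun i => ⌊x i / h⌋)‖ₑ ^ 2 ≤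
      ENNReal.ofReal (2 ^ N * N * h ^ 2) * ∫⁻ x, ‖gradient φ x‖ₑ ^ 2 := by
  have hc := hφ.continuous
  have hne : ENNReal.ofReal h ^ N ≠ 0 := pow_ne_zero _ (by simpa using hh)
  have hnt : ENNReal.ofReal h ^ N ≠ ⊤ := ENNReal.pow_ne_top ENNReal.ofReal_ne_top
  have hm : Measurable fun q : E N × E N => ‖φ (q.1 + q.2) - φ q.1‖ₑ ^ 2 :=
    (((hc.comp (by fun_prop)).sub (hc.comp (by fun_prop)) :
      Continuous fun q : E N × E N => φ (q.1 + q.2) - φ q.1).enorm.measurable).pow_const 2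
  calc _ ≤ ∫⁻ x, (ENNReal.ofReal h ^ N)⁻¹ * ∫⁻ z in centredCube N h, ‖φ (x + z) - φ x‖ₑ ^ 2 :=
        lintegral_mono fun x => enorm_sub_cubeMean_sq_le hh hc hφc (fun i => rfl)
    _ = (ENNReal.ofReal h ^ N)⁻¹ * ∫⁻ z in centredCube N h, ∫⁻ x, ‖φ (x + z) - φ x‖ₑ ^ 2 := by
        rw [lintegral_const_mul _ hm.lintegral_prod_right',
          lintegral_lintegral_swap hm.aemeasurable]
    _ ≤ (ENNReal.ofReal h ^ N)⁻¹ * ∫⁻ z in centredCube N h,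
          ENNReal.ofReal (N * h ^ 2) * ∫⁻ x, ‖gradient φ x‖ₑ ^ 2 := by
        refine mul_le_mul_right ?_ _
        refine setLIntegral_mono' (measurableSet_centredCube h) fun z hz => ?_
        refine (lintegral_enorm_translate_sub_sq_le hφ z).trans ?_
        gcongr
        exact norm_le_of_mem_centredCube hz
    _ = _ := by
        -- The factor `2 ^ N` is the ratio of the volumes `(2h)^N` and `h^N`; `N * h ^ 2` bounds
        -- `‖z‖²` on the centred cube.
        rw [setLIntegral_const, volume_centredCube, ENNReal.ofReal_mul zero_le_two, mul_pow,
          mul_assoc (2 ^ N : ℝ), ENNReal.ofReal_mul (p := 2 ^ N) (by positivity),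
          ENNReal.ofReal_pow zero_le_two]
        rw [show ∀ a b c d e : ENNReal, a * (b * c * (d * e)) = (a * e) * (d * b * c) by
          intros; ring, ENNReal.inv_mul_cancel hne hnt, one_mul]

end Rellich

/-! ### Approximation of the embedding by finite-rank operators. -/

section Compactness

variable {N : ℕ}

theorem measure_restrict_ne_top (U : BoundedOpen N) (s : Set (E N)) :
    volume.restrict U.carrier s ≠ ⊤ :=
  ((measure_mono (subset_univ s)).trans_lt (by
    rw [Measure.restrict_apply_univ]; exact U.isBounded.measure_lt_top)).ne

/-- The indicator of a cube as an element of `L²(U)`. -/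
def cubeIndicator (U : BoundedOpen N) {h : ℝ} (hh : 0 < h) (k : Fin N → ℤ) : L2 U :=
  indicatorConstLp 2 (measurableSet_cube hh k) (measure_restrict_ne_top U _) (1 : ℝ)

/-- The step functions on the cubes of side `h` with index in `S`. -/
def stepSpace (U : BoundedOpen N) {h : ℝ} (hh : 0 < h) (S : Finset (Fin N → ℤ)) :
    Submodule ℝ (L2 U) :=
  Submodule.span ℝ (cubeIndicator U hh '' S)

instance (U : BoundedOpen N) {h : ℝ} (hh : 0 < h) (S : Finset (Fin N → ℤ)) :
    FiniteDimensional ℝ (stepSpace U hh S) :=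
  FiniteDimensional.span_of_finite ℝ (S.finite_toSet.image _)

theorem exists_mem_stepSpace (U : BoundedOpen N) {h : ℝ} (hh : 0 < h) (S : Finset (Fin N → ℤ))
    (c : (Fin N → ℤ) → ℝ) : ∃ v ∈ stepSpace U hh S,
      ∀ᵐ x ∂(volume.restrict U.carrier), (fun i => ⌊x i / h⌋) ∈ S →
        v x = c (fun i => ⌊x i / h⌋) := by
  classical
  have key : ∀ S' : Finset (Fin N → ℤ), S' ⊆ S → ∃ v ∈ stepSpace U hh S,
      (v : E N → ℝ) =ᵐ[volume.restrict U.carrier]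
        fun x => ∑ k ∈ S', (cube h k).indicator (fun _ => c k) x := by
    intro S'
    induction S' using Finset.induction_on with
    | empty =>
      intro _
      refine ⟨0, zero_mem _, ?_⟩
      filter_upwards [Lp.coeFn_zero ℝ 2 (volume.restrict U.carrier)] with x hx
      simpa using hx
    | insert k S' hk ih =>
      intro hS
      obtain ⟨v, hv, hvx⟩ := ih ((Finset.subset_insert k S').trans hS)
      refine ⟨c k • cubeIndicator U hh k + v, add_mem (Submodule.smul_mem _ _
        (Submodule.subset_span ⟨k, hS (Finset.mem_insert_self k S'), rfl⟩)) hv, ?_⟩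
      filter_upwards [hvx, Lp.coeFn_add (c k • cubeIndicator U hh k) v,
        Lp.coeFn_smul (c k) (cubeIndicator U hh k), indicatorConstLp_coeFn (p := 2)
          (hs := measurableSet_cube hh k) (hμs := measure_restrict_ne_top U _) (c := (1 : ℝ))]
        with x h1 h2 h3 h4
      rw [h2, Pi.add_apply, h3, Pi.smul_apply, h1, Finset.sum_insert hk, cubeIndicator, h4]
      congr 1
      by_cases hx : x ∈ cube h k <;> simp [hx]
  obtain ⟨v, hv, hvx⟩ := key S subset_rfl
  refine ⟨v, hv, ?_⟩
  filter_upwards [hvx] with x hx hxS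
  rw [hx, Finset.sum_eq_single_of_mem _ hxS]
  · exact Set.indicator_of_mem (show x ∈ cube h _ from fun i => rfl) _
  · intro k _ hk
    exact Set.indicator_of_notMem (fun hxk => hk (funext fun i => (hxk i).symm)) _

theorem exists_finset_floor_mem (U : BoundedOpen N) (h : ℝ) (hh : 0 < h) :
    ∃ S : Finset (Fin N → ℤ), ∀ x ∈ U.carrier, (fun i => ⌊x i / h⌋) ∈ S := by
  obtain ⟨R, hR⟩ := U.isBounded.exists_norm_le
  refine ⟨Fintype.piFinset fun _ => Finset.Icc ⌊-R / h⌋ ⌊R / h⌋, fun x hx => ?_⟩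
  rw [Fintype.mem_piFinset]
  intro i
  have h1 := (abs_le.1 ((PiLp.norm_apply_le x i).trans (hR x hx)))
  rw [Finset.mem_Icc]
  exact ⟨Int.floor_le_floor (div_le_div_of_nonneg_right h1.1 hh.le),
    Int.floor_le_floor (div_le_div_of_nonneg_right h1.2 hh.le)⟩

theorem enorm_sq_Lp {F : Type*} [NormedAddCommGroup F] {μ : Measure (E N)} (f : Lp F 2 μ) :
    ‖f‖ₑ ^ 2 = ∫⁻ x, ‖f x‖ₑ ^ 2 ∂μ := by
  have := eLpNorm_nnreal_pow_eq_lintegral (μ := μ) (f := f) (p := 2) two_ne_zero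
  rw [Lp.enorm_def]
  simpa using this

/-- The projection is the best approximation from the step functions, hence no worse than the cube
means of a test function. The estimate is a closed condition on `w`, so it passes to the closure. -/
theorem norm_sub_starProjection_le {U : BoundedOpen N} {h : ℝ} (hh : 0 < h)
    {S : Finset (Fin N → ℤ)} (hS : ∀ x ∈ U.carrier, (fun i => ⌊x i / h⌋) ∈ S)
    {w : L2 U × L2vec U} (hw : w ∈ graphClosure U) :
    ‖w.1 - (stepSpace U hh S).starProjection w.1‖ ≤ √(2 ^ N * N) * h * ‖w.2‖ := by
  have hclosed : IsClosed {w : L2 U × L2vec U |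
      ‖w.1 - (stepSpace U hh S).starProjection w.1‖ ≤ √(2 ^ N * N) * h * ‖w.2‖} :=
    isClosed_le (by fun_prop) (by fun_prop)
  refine closure_minimal ?_ hclosed hw
  rintro w ⟨φ, hφ, h1, h2⟩
  obtain ⟨v, hv, hvx⟩ := exists_mem_stepSpace U hh S (cubeMean h φ)
  have e1 : ‖w.1 - (stepSpace U hh S).starProjection w.1‖ ≤ ‖w.1 - v‖ := by
    rw [Submodule.starProjection_minimal]
    exact ciInf_le ⟨0, by rintro _ ⟨y, rfl⟩; exact norm_nonneg _⟩ (⟨v, hv⟩ : stepSpace U hh S)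
  refine e1.trans ?_
  have e2 : ‖w.1 - v‖ₑ ^ 2 ≤ ENNReal.ofReal (2 ^ N * N * h ^ 2) * ‖w.2‖ₑ ^ 2 := by
    rw [enorm_sq_Lp, enorm_sq_Lp]
    have e3 : ∫⁻ x in U.carrier, ‖(w.1 - v : L2 U) x‖ₑ ^ 2 =
        ∫⁻ x in U.carrier, ‖φ x - cubeMean h φ (fun i => ⌊x i / h⌋)‖ₑ ^ 2 := by
      refine lintegral_congr_ae ?_
      filter_upwards [h1, hvx, Lp.coeFn_sub w.1 v, ae_restrict_mem U.isOpen.measurableSet]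
        with x h1 h2 h3 hx
      rw [h3, Pi.sub_apply, h1, h2 (hS x hx)]
    have e4 : ∫⁻ x in U.carrier, ‖w.2 x‖ₑ ^ 2 = ∫⁻ x, ‖gradient φ x‖ₑ ^ 2 := by
      refine (lintegral_congr_ae ?_).trans (setLIntegral_eq_of_support_subset (s := U.carrier) ?_)
      · filter_upwards [h2] with x hx
        rw [hx]
      · intro x hx
        refine hφ.support (support_fderiv_subset ℝ (Function.mem_support.2 fun h0 => hx ?_))
        simp [gradient, h0]
    rw [e3, e4]
    exact (setLIntegral_le_lintegral _ _).trans
      (lintegral_sub_cubeMean_sq_le hh hφ.smooth hφ.compact)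
  have e5 : ‖w.1 - v‖ ^ 2 ≤ 2 ^ N * N * h ^ 2 * ‖w.2‖ ^ 2 := by
    rw [← ofReal_norm, ← ofReal_norm, ← ENNReal.ofReal_pow (norm_nonneg _),
      ← ENNReal.ofReal_pow (norm_nonneg _), ← ENNReal.ofReal_mul (by positivity)] at e2
    exact (ENNReal.ofReal_le_ofReal_iff (by positivity)).1 e2
  refine le_of_sq_le_sq (e5.trans_eq ?_) (by positivity)
  rw [mul_pow, mul_pow, Real.sq_sqrt (by positivity)]

/-- **Rellich's theorem**: the embedding `H¹₀(U) → L²(U)` is compact. -/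
theorem isCompactOperator_val [NeZero N] (U : BoundedOpen N) : IsCompactOperator (val U) := by
  choose S hS using fun n : ℕ => exists_finset_floor_mem U (1 / ((n : ℝ) + 1)) (by positivity)
  have hpos : ∀ n : ℕ, (0 : ℝ) < 1 / ((n : ℝ) + 1) := fun n => by positivity
  -- At mesh `1 / (n + 1)` the projections have finite rank and, composed with `val U`, converge to
  -- it in operator norm.
  refine isCompactOperator_of_tendsto (l := Filter.atTop)
    (F := fun n => (stepSpace U (hpos n) (S n)).starProjection ∘L val U) ?_ ?_
  · rw [tendsto_iff_norm_sub_tendsto_zero]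
    refine squeeze_zero (g := fun n : ℕ => √(2 ^ N * N) * (1 / ((n : ℝ) + 1)))
      (fun _ => norm_nonneg _) (fun n => ?_) ?_
    · refine ContinuousLinearMap.opNorm_le_bound _ (by positivity) fun u => ?_
      rw [sub_apply, norm_sub_rev]
      exact norm_sub_starProjection_le (hpos n) (hS n) u.2
    · simpa using (tendsto_one_div_add_atTop_nhds_zero_nat (𝕜 := ℝ)).const_mul (√(2 ^ N * N))
  · refine Filter.Eventually.of_forall fun n => ?_
    have h1 : IsCompactOperator (stepSpace U (hpos n) (S n)).orthogonalProjectionOnto :=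
      isCompactOperator_of_locallyCompactSpace_dom _
    exact (h1.clm_comp (stepSpace U (hpos n) (S n)).subtypeL).comp_clm (val U)

theorem isCompactOperator_massOp [NeZero N] (U : BoundedOpen N) : IsCompactOperator (massOp U) :=
  (isCompactOperator_val U).clm_comp (ContinuousLinearMap.adjoint (val U))

end Compactness

/-! ### Eigenbases of compact selfadjoint operators -/

section Eigenbasis

universe u

variable {X : Type u} [NormedAddCommGroup X] [InnerProductSpace ℝ X]

/-- Distinct basis vectors with `|ν i| ≥ ε` have orthogonal images, at least `ε` apart. The image of
the unit ball is totally bounded, and each ball of radius `ε / 2` contains at most one of them. -/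
theorem finite_eigenvalues_ge {ι : Type*} {b : HilbertBasis ι ℝ X} {T : X →L[ℝ] X}
    {ν : ι → ℝ} (hT : ∀ i, T (b i) = ν i • b i) (hc : IsCompactOperator T) {ε : ℝ} (hε : 0 < ε) :
    {i | ε ≤ |ν i|}.Finite := by
  have h1 : TotallyBounded (T '' Metric.closedBall 0 1) :=
    (hc.isCompact_closure_image_closedBall (f := (T : X →ₗ[ℝ] X)) 1).totallyBounded.subset
      subset_closure
  obtain ⟨t, ht, hsub⟩ := Metric.totallyBounded_iff.1 h1 (ε / 2) (by positivity)
  have h2 : ∀ i, ∃ y ∈ t, dist (T (b i)) y < ε / 2 := fun i => by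
    have := hsub ⟨b i, by simp [b.orthonormal.1 i], rfl⟩
    simpa using this
  choose y hyt hy using h2
  refine Set.Finite.of_finite_image (f := y) (ht.subset (by rintro _ ⟨i, -, rfl⟩; exact hyt i)) ?_
  intro i hi j hj hij
  by_contra hne
  have h3 : dist (T (b i)) (T (b j)) < ε := by
    have := dist_triangle_right (T (b i)) (T (b j)) (y i)
    have h4 := hy j
    rw [← hij] at h4
    linarith [hy i]
  have h5 : ‖T (b i) - T (b j)‖ ^ 2 = ν i ^ 2 + ν j ^ 2 := by
    rw [norm_sub_sq_real, hT, hT, real_inner_smul_left, real_inner_smul_right, norm_smul,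
      norm_smul, b.orthonormal.1, b.orthonormal.1, b.orthonormal.2 hne]
    simp
  rw [dist_eq_norm] at h3
  have h6 : ε ^ 2 ≤ ν i ^ 2 := by
    rw [← sq_abs (ν i)]
    exact pow_le_pow_left₀ hε.le hi 2
  have h7 := pow_lt_pow_left₀ h3 (norm_nonneg _) two_ne_zero
  nlinarith [sq_nonneg (ν j)]

/-- Hilbert bases of all eigenspaces, the kernel included, are put together; the spectral theorem
says that nothing is orthogonal to them. Real numbers that are not eigenvalues contribute empty
bases. -/
theorem exists_hilbertBasis_eigenvectors [CompleteSpace X] {T : X →L[ℝ] X}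
    (hc : IsCompactOperator T) (hs : (T : X →ₗ[ℝ] X).IsSymmetric) :
    ∃ (ι : Type u) (b : HilbertBasis ι ℝ X) (ν : ι → ℝ), ∀ i, T (b i) = ν i • b i := by
  have hcl : ∀ μ : ℝ, CompleteSpace (Module.End.eigenspace (T : X →ₗ[ℝ] X) μ) := fun μ => by
    have : IsClosed (Module.End.eigenspace (T : X →ₗ[ℝ] X) μ : Set X) := by
      have h1 : (Module.End.eigenspace (T : X →ₗ[ℝ] X) μ : Set X) = {x | T x = μ • x} := by
        ext x
        exact Module.End.mem_eigenspace_iff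
      rw [h1]
      exact isClosed_eq (by fun_prop) (by fun_prop)
    exact this.completeSpace_coe
  choose w e he using fun μ : ℝ =>
    exists_hilbertBasis ℝ (Module.End.eigenspace (T : X →ₗ[ℝ] X) μ)
  have hv := hs.orthogonalFamily_eigenspaces.orthonormal_sigma_orthonormal
    (v_family := fun μ => e μ) fun μ => (e μ).orthonormal
  have hbot : (Submodule.span ℝ (Set.range fun a : Σ μ, w μ =>
      (Module.End.eigenspace (T : X →ₗ[ℝ] X) a.1).subtypeₗᵢ (e a.1 a.2)))ᗮ = ⊥ := by
    rw [eq_bot_iff, ← ContinuousLinearMap.orthogonalComplement_iSup_eigenspaces_eq_bot hc hs]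
    intro x hx
    rw [← Submodule.iInf_orthogonal, Submodule.mem_iInf]
    intro μ y hy
    have h2 : innerSL ℝ x ∘L (Module.End.eigenspace (T : X →ₗ[ℝ] X) μ).subtypeL = 0 := by
      refine ContinuousLinearMap.ext_on (s := Set.range (e μ))
        (Submodule.dense_iff_topologicalClosure_eq_top.2 (e μ).dense_span) ?_
      rintro _ ⟨i, rfl⟩
      have h3 := hx _ (Submodule.subset_span ⟨⟨μ, i⟩, rfl⟩)
      rw [real_inner_comm] at h3
      exact h3
    have h4 := DFunLike.congr_fun h2 ⟨y, hy⟩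
    rw [real_inner_comm]
    exact h4
  refine ⟨Σ μ, w μ, HilbertBasis.mkOfOrthogonalEqBot hv hbot, fun a => a.1, fun a => ?_⟩
  rw [HilbertBasis.coe_mkOfOrthogonalEqBot]
  exact Module.End.mem_eigenspace_iff.1 (e a.1 a.2).2

end Eigenbasis

/-! ### Sums over sequences with the same distribution function -/

section Counting

theorem eventually_countP_le_eq (m : Multiset ℝ) (a : ℝ) :
    ∀ᶠ x in nhdsWithin a (Ioi a), m.countP (x ≤ ·) = m.countP (a < ·) := by
  induction m using Multiset.induction_on with
  | empty => simp
  | cons y m ih =>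
    have h1 : ∀ᶠ x in nhdsWithin a (Ioi a), (x ≤ y ↔ a < y) := by
      rcases lt_or_ge a y with h | h
      · filter_upwards [nhdsWithin_le_nhds (Iio_mem_nhds h)] with x hx
        exact ⟨fun _ => h, fun _ => le_of_lt hx⟩
      · filter_upwards [self_mem_nhdsWithin] with x hx
        exact ⟨fun h' => lt_of_lt_of_le hx h', fun h' => absurd h (not_le.2 h')⟩
    filter_upwards [ih, h1] with x hx hy
    simp only [Multiset.countP_cons, hx, hy]

theorem countP_le_eq_count_add (m : Multiset ℝ) (a : ℝ) :
    m.countP (a ≤ ·) = m.count a + m.countP (a < ·) := by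
  induction m using Multiset.induction_on with
  | empty => simp
  | cons y m ih =>
    simp only [Multiset.countP_cons, Multiset.count_cons, ih]
    rcases lt_trichotomy a y with h | rfl | h
    · simp only [h, h.le, h.ne, if_true, if_false]; omega
    · simp only [le_refl, lt_irrefl, if_true, if_false]; omega
    · simp only [not_le.2 h, not_lt.2 h.le, h.ne', if_false]; omega

/-- The multiplicity of `a` is the jump of the counting function at `a`. It is read off from some `x
> a` so close that neither multiset has an element in `(a, x)`. -/
theorem multiset_eq_of_countP_le {m m' : Multiset ℝ}
    (h : ∀ x, m.countP (x ≤ ·) = m'.countP (x ≤ ·)) : m = m' := by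
  ext a
  obtain ⟨x, h1, h2⟩ := ((eventually_countP_le_eq m a).and (eventually_countP_le_eq m' a)).exists
  have h3 := countP_le_eq_count_add m a
  have h4 := countP_le_eq_count_add m' a
  have h5 := h a
  have h6 := h x
  omega

/-- The level `max ε x` is positive whatever `x` is, so counting functions known only at positive
levels determine the truncated multiset. -/
theorem countP_map_toFinset {κ : Type*} {g : κ → ℝ} {ε : ℝ} (hg : {k | ε ≤ g k}.Finite) (x : ℝ) :
    (hg.toFinset.val.map g).countP (x ≤ ·) = {k | max ε x ≤ g k}.ncard := by
  classical
  rw [Multiset.countP_map]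
  have : {k | max ε x ≤ g k} = (hg.toFinset.filter fun k => x ≤ g k : Finset κ) := by
    ext k
    simp
  rw [this, Set.ncard_coe_finset]
  rfl

/-- Only values at least `ε` contribute. They form finite multisets, which coincide because their
counting functions do. -/
theorem finsum_eq_finsum_of_ncard_ge_eq {κ ι : Type*} {g : κ → ℝ} {ν : ι → ℝ}
    (hg : ∀ x > 0, {k | x ≤ g k}.Finite) (hν : ∀ x > 0, {i | x ≤ ν i}.Finite)
    (h : ∀ x > 0, {k | x ≤ g k}.ncard = {i | x ≤ ν i}.ncard) {f : ℝ → ℤ} {ε : ℝ} (hε : 0 < ε)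
    (hf : ∀ y < ε, f y = 0) : ∑ᶠ k, f (g k) = ∑ᶠ i, f (ν i) := by
  rw [finsum_eq_sum_of_support_subset (s := (hg ε hε).toFinset),
    finsum_eq_sum_of_support_subset (s := (hν ε hε).toFinset)]
  · have hm : (hg ε hε).toFinset.val.map g = (hν ε hε).toFinset.val.map ν := by
      refine multiset_eq_of_countP_le fun x => ?_
      rw [countP_map_toFinset, countP_map_toFinset]
      exact h _ (lt_max_of_lt_left hε)
    have e1 := congrArg (fun m => (Multiset.map f m).sum) hm
    simp only [Multiset.map_map] at e1
    exact e1
  · intro i hi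
    simp only [Finite.coe_toFinset, mem_ofPred_eq]
    by_contra! hlt
    exact hi (hf _ hlt)
  · intro i hi
    simp only [Finite.coe_toFinset, mem_ofPred_eq]
    by_contra! hlt
    exact hi (hf _ hlt)

/-- Finitely many values lie above `x / 2`, so there is a gap just below `x`. This gap compensates
for the infimum in `dirichletEigenvalue`, whose attainment is not assumed. -/
theorem exists_lt_setOf_le_eq {ι : Type*} {ν : ι → ℝ} (hν : ∀ x > 0, {i | x ≤ ν i}.Finite) {x : ℝ}
    (hx : 0 < x) : ∃ y, 0 < y ∧ y < x ∧ {i | y ≤ ν i} = {i | x ≤ ν i} := by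
  have h1 : ∀ᶠ y in nhdsWithin x (Iio x), ∀ i ∈ {i | x / 2 ≤ ν i}, ν i < x → ν i < y := by
    rw [Filter.eventually_all_finite (hν _ (by positivity))]
    intro i _
    by_cases h : ν i < x
    · filter_upwards [nhdsWithin_le_nhds (Ioi_mem_nhds h)] with y hy _
      exact hy
    · exact Filter.Eventually.of_forall fun y h' => absurd h' h
  have h2 : ∀ᶠ y in nhdsWithin x (Iio x), x / 2 < y :=
    nhdsWithin_le_nhds (Ioi_mem_nhds (by linarith))
  obtain ⟨y, hy1, hy2, hy3⟩ := (h1.and (h2.and self_mem_nhdsWithin)).exists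
  refine ⟨y, by linarith, hy3, subset_antisymm (fun i hi => ?_) fun i hi => ?_⟩
  · simp only [mem_ofPred_eq] at hi ⊢
    by_contra! hlt
    exact absurd (hy1 i (hy2.le.trans hi) hlt) (not_lt.2 hi)
  · exact le_trans (le_of_lt hy3) hi

end Counting

/-! ### The Dirichlet eigenvalues -/

section Dirichlet

variable {N : ℕ} [NeZero N] {U : BoundedOpen N}

theorem isSymmetric_massOp (U : BoundedOpen N) : (massOp U : H01 U →ₗ[ℝ] H01 U).IsSymmetric := by
  intro u v
  rw [ContinuousLinearMap.coe_coe, inner_massOp, real_inner_comm, inner_massOp]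
  simp only [mul_comm]

theorem mem_dirichletEigenspace {u : H01 U} {α : ℝ} :
    u ∈ dirichletEigenspace U α ↔ u = α • massOp U u := by
  have : u ∈ dirichletEigenspace U α ↔
      ∀ v, inner ℝ u v = α * ∫ x in U.carrier, val U u x * val U v x := Iff.rfl
  rw [this, ext_iff_inner_right ℝ]
  simp_rw [real_inner_smul_left, inner_massOp]

variable {ι : Type*} {b : HilbertBasis ι ℝ (H01 U)} {ν : ι → ℝ}

theorem massOp_eigenvalue_nonneg (hb : ∀ i, massOp U (b i) = ν i • b i) (i : ι) : 0 ≤ ν i := by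
  have h1 : inner ℝ (massOp U (b i)) (b i) = ν i := by
    rw [hb, real_inner_smul_left, real_inner_self_eq_norm_sq, b.orthonormal.1]
    simp
  rw [← h1, massOp, ContinuousLinearMap.comp_apply, ContinuousLinearMap.adjoint_inner_left]
  exact real_inner_self_nonneg

theorem massOp_finite_ge (hb : ∀ i, massOp U (b i) = ν i • b i) {x : ℝ} (hx : 0 < x) :
    {i | x ≤ ν i}.Finite := by
  refine (finite_eigenvalues_ge hb (isCompactOperator_massOp U) hx).subset fun i hi => ?_
  exact (show x ≤ ν i from hi).trans (le_abs_self _)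

theorem dirichletEigenspace_of_pos {α : ℝ} (hα : 0 < α) : dirichletEigenspace U α =
    Module.End.eigenspace (massOp U : H01 U →ₗ[ℝ] H01 U) (1 / α) := by
  ext u
  rw [mem_dirichletEigenspace, Module.End.mem_eigenspace_iff, ContinuousLinearMap.coe_coe, one_div,
    eq_inv_smul_iff₀ hα.ne', eq_comm]

/-- Testing the equation with `u` itself gives `‖u‖² = α * ‖val U u‖² ≤ 0`. -/
theorem dirichletEigenspace_of_nonpos {α : ℝ} (hα : α ≤ 0) : dirichletEigenspace U α = ⊥ := by
  rw [eq_bot_iff]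
  intro u hu
  rw [mem_dirichletEigenspace] at hu
  have h1 : inner ℝ u u = α * inner ℝ (massOp U u) u := by
    conv_lhs => rw [hu]
    rw [real_inner_smul_left, ← hu]
  rw [massOp, ContinuousLinearMap.comp_apply, ContinuousLinearMap.adjoint_inner_left] at h1
  have h2 : inner ℝ u u ≤ 0 := by
    rw [h1]
    exact mul_nonpos_of_nonpos_of_nonneg hα real_inner_self_nonneg
  exact (real_inner_self_nonpos.1 h2 : u = 0)

theorem rank_dirichlet_of_nonpos {a : ℝ} (ha : a ≤ 0) :
    Module.rank ℝ (⨆ β ∈ Iic a, dirichletEigenspace U β : Submodule ℝ (H01 U)) = 0 := by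
  have : (⨆ β ∈ Iic a, dirichletEigenspace U β : Submodule ℝ (H01 U)) = ⊥ := by
    rw [eq_bot_iff]
    exact iSup₂_le fun β hβ => (dirichletEigenspace_of_nonpos (le_trans hβ ha)).le
  rw [this, rank_bot]

theorem rank_dirichlet_of_pos (hb : ∀ i, massOp U (b i) = ν i • b i) {a : ℝ} (ha : 0 < a) :
    Module.rank ℝ (⨆ β ∈ Iic a, dirichletEigenspace U β : Submodule ℝ (H01 U)) =
      ({i | 1 / a ≤ ν i}.ncard : Cardinal) := by
  have ha' : 0 < 1 / a := by positivity
  have : (⨆ β ∈ Iic a, dirichletEigenspace U β : Submodule ℝ (H01 U)) =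
      ⨆ μ ∈ Ici (1 / a), Module.End.eigenspace (massOp U : H01 U →ₗ[ℝ] H01 U) μ := by
    apply le_antisymm
    · refine iSup₂_le fun β hβ => ?_
      rcases le_or_gt β 0 with h | h
      · rw [dirichletEigenspace_of_nonpos h]
        exact bot_le
      · rw [dirichletEigenspace_of_pos h]
        exact le_iSup₂_of_le (1 / β) (one_div_le_one_div_of_le h hβ) le_rfl
    · refine iSup₂_le fun μ hμ => ?_
      have hμ0 : 0 < μ := lt_of_lt_of_le ha' hμ
      have h1 := dirichletEigenspace_of_pos (U := U) (α := 1 / μ) (by positivity)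
      rw [one_div_one_div] at h1
      rw [← h1]
      exact le_iSup₂_of_le (1 / μ) ((one_div_le ha hμ0).1 hμ) le_rfl
  rw [this, iSup_eigenspace_eq_span hb (W := Ici (1 / a)) (massOp_finite_ge hb ha')]
  exact rank_span_hilbertBasis b (massOp_finite_ge hb ha')

/-- Expresses that `1 / α_k` lists the positive `ν i` in decreasing order with multiplicity. Should
no `a` qualify in the definition of `α_k`, the defaults `sInf ∅ = 0` and `1 / 0 = 0` make both sides
false. -/
theorem le_one_div_dirichletEigenvalue_iff (hb : ∀ i, massOp U (b i) = ν i • b i) {x : ℝ}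
    (hx : 0 < x) (k : ℕ) :
    x ≤ 1 / dirichletEigenvalue U k ↔ k < {i | x ≤ ν i}.ncard := by
  set A : Set ℝ := {a : ℝ | ((k + 1 : ℕ) : Cardinal) ≤
    Module.rank ℝ (⨆ β ∈ Iic a, dirichletEigenspace U β : Submodule ℝ (H01 U))} with hA
  have hα : dirichletEigenvalue U k = sInf A := rfl
  have hApos : ∀ a ∈ A, 0 < a := by
    intro a ha
    by_contra! h
    rw [hA, mem_ofPred_eq, rank_dirichlet_of_nonpos h] at ha
    simp at ha
  have hAmem : ∀ a, 0 < a → (a ∈ A ↔ k < {i | 1 / a ≤ ν i}.ncard) := by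
    intro a ha
    rw [hA, mem_ofPred_eq, rank_dirichlet_of_pos hb ha, Nat.cast_le, Nat.succ_le_iff]
  have hbdd : BddBelow A := ⟨0, fun a ha => (hApos a ha).le⟩
  constructor
  · intro h
    have hpos : 0 < sInf A := by
      rw [← hα]
      exact one_div_pos.1 (hx.trans_le h)
    have hne : A.Nonempty := by
      by_contra! he
      rw [he, Real.sInf_empty] at hpos
      exact lt_irrefl _ hpos
    obtain ⟨y, hy0, hyx, hy⟩ := exists_lt_setOf_le_eq (fun x hx => massOp_finite_ge hb hx) hx
    have h1 : sInf A < 1 / y := by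
      rw [← hα]
      exact ((le_one_div hx (hα ▸ hpos)).1 h).trans_lt (one_div_lt_one_div_of_lt hy0 hyx)
    obtain ⟨a, ha, hay⟩ := exists_lt_of_csInf_lt hne h1
    have ha0 := hApos a ha
    refine ((hAmem a ha0).1 ha).trans_le ?_
    rw [← hy]
    refine Set.ncard_le_ncard (fun i hi => ?_) (massOp_finite_ge hb hy0)
    exact le_trans ((lt_one_div ha0 hy0).1 hay).le hi
  · intro h
    have hmem : 1 / x ∈ A := (hAmem _ (by positivity)).2 (by rwa [one_div_one_div])
    have h1 : sInf A ≤ 1 / x := csInf_le hbdd hmem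
    -- Each `a ∈ A` satisfies `1 / a ≤ ν i ≤ ‖massOp U‖` for some `i`; the summand `1` guards
    -- against a vanishing norm.
    have h2 : 0 < sInf A := by
      refine lt_of_lt_of_le (b := 1 / (‖massOp U‖ + 1)) (by positivity)
        (le_csInf ⟨_, hmem⟩ fun a ha => ?_)
      have ha0 := hApos a ha
      obtain ⟨i, hi⟩ : {i | 1 / a ≤ ν i}.Nonempty := by
        rw [← Set.ncard_pos (massOp_finite_ge hb (by positivity))]
        exact Nat.zero_lt_of_lt ((hAmem a ha0).1 ha)
      have h3 : ν i ≤ ‖massOp U‖ := by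
        have := (massOp U).le_opNorm (b i)
        rw [hb, norm_smul, b.orthonormal.1, mul_one, mul_one] at this
        exact (le_abs_self _).trans this
      rw [one_div_le (by positivity) ha0]
      exact (le_trans hi h3).trans (by linarith)
    rw [hα]
    exact (le_one_div h2 hx).1 h1

theorem finsum_dirichletEigenvalue (hb : ∀ i, massOp U (b i) = ν i • b i) {f : ℝ → ℤ} {ε : ℝ}
    (hε : 0 < ε) (hf : ∀ y < ε, f y = 0) :
    ∑ᶠ k, f (1 / dirichletEigenvalue U k) = ∑ᶠ i, f (ν i) := by
  have h1 : ∀ x > 0, {k | x ≤ 1 / dirichletEigenvalue U k} = Iio {i | x ≤ ν i}.ncard := by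
    intro x hx
    ext k
    exact le_one_div_dirichletEigenvalue_iff hb hx k
  refine finsum_eq_finsum_of_ncard_ge_eq (fun x hx => ?_) (fun x hx => massOp_finite_ge hb hx)
    (fun x hx => ?_) hε hf
  · rw [h1 x hx]
    exact Set.finite_Iio _
  · rw [h1 x hx, Set.ncard_eq_toFinset_card']
    simp

end Dirichlet

/-! ### Dependence of the Hessian matrix on the parameter -/

section Hessian

variable {V Y : Type*} [NormedAddCommGroup V] [NormedSpace ℝ V] [NormedAddCommGroup Y]
  [NormedSpace ℝ Y]

/-- At the ends of the parameter interval only one-sided derivatives are available, so smoothness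
comes from `fderivWithin` on the product set. Its restriction to the directions of `V` is an honest
`fderiv`, because `V` is the whole space. -/
theorem contDiffOn_partial_fderiv {g : ℝ × V → Y} {n m : WithTop ℕ∞} (hmn : m + 1 ≤ n)
    (hg : ContDiffOn ℝ n g (Icc (0 : ℝ) 1 ×ˢ univ)) :
    ContDiffOn ℝ m (fun q : ℝ × V => fderiv ℝ (fun u => g (q.1, u)) q.2)
      (Icc (0 : ℝ) 1 ×ˢ univ) := by
  have hu : UniqueDiffOn ℝ (Icc (0 : ℝ) 1 ×ˢ (univ : Set V)) :=
    (uniqueDiffOn_Icc zero_lt_one).prod uniqueDiffOn_univ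
  have h1 : ContDiffOn ℝ m (fun q => (fderivWithin ℝ g (Icc (0 : ℝ) 1 ×ˢ univ) q) ∘L
      ContinuousLinearMap.inr ℝ ℝ V) (Icc (0 : ℝ) 1 ×ˢ univ) :=
    (hg.fderivWithin hu hmn).clm_comp contDiffOn_const
  refine h1.congr fun q hq => ?_
  have hn : n ≠ 0 := by
    rintro rfl
    exact absurd (le_trans le_add_self hmn) (by simp)
  have h2 : HasFDerivWithinAt g (fderivWithin ℝ g (Icc (0 : ℝ) 1 ×ˢ univ) q)
      (Icc (0 : ℝ) 1 ×ˢ univ) (q.1, q.2) :=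
    ((hg.differentiableOn hn) q hq).hasFDerivWithinAt
  have h3 : HasFDerivAt (fun u : V => (q.1, u)) (ContinuousLinearMap.inr ℝ ℝ V) q.2 :=
    hasFDerivAt_prodMk_right q.1 q.2
  have h4 := h2.comp q.2 (h3.hasFDerivWithinAt (s := univ)) fun u _ => ⟨hq.1, mem_univ u⟩
  rw [hasFDerivWithinAt_univ] at h4
  exact h4.fderiv

variable {N p : ℕ} {U : BoundedOpen N} {F : ℝ → E N → E p → ℝ}

theorem contDiffOn_slice (hF : ContDiffOn ℝ 2 (fun z : ℝ × E N × E p => F z.1 z.2.1 z.2.2)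
    (Icc 0 1 ×ˢ U.carrier ×ˢ univ)) {x : E N} (hx : x ∈ U.carrier) :
    ContDiffOn ℝ 2 (fun q : ℝ × E p => F q.1 x q.2) (Icc (0 : ℝ) 1 ×ˢ univ) := by
  have h1 : ContDiff ℝ 2 (fun q : ℝ × E p => (q.1, x, q.2)) := by fun_prop
  exact hF.comp h1.contDiffOn fun q hq => ⟨hq.1, hx, mem_univ _⟩

theorem continuousOn_hessMatrix (hF : ContDiffOn ℝ 2
    (fun z : ℝ × E N × E p => F z.1 z.2.1 z.2.2) (Icc 0 1 ×ˢ U.carrier ×ˢ univ)) {x : E N}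
    (hx : x ∈ U.carrier) (u : E p) :
    ContinuousOn (fun s => hessMatrix (F s x) u) (Icc (0 : ℝ) 1) := by
  have h1 := contDiffOn_partial_fderiv (m := 1) (n := 2) (by norm_num [one_add_one_eq_two])
    (contDiffOn_slice hF hx)
  have h2 := (contDiffOn_partial_fderiv (m := 0) (n := 1) (by simp) h1).continuousOn
  have h3 : ContinuousOn (fun s : ℝ => fderiv ℝ (fderiv ℝ (F s x)) u) (Icc (0 : ℝ) 1) :=
    h2.comp (f := fun s => (s, u)) (by fun_prop) fun s hs => ⟨hs, mem_univ _⟩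
  refine continuousOn_pi.2 fun i => continuousOn_pi.2 fun j => ?_
  exact (h3.clm_apply continuousOn_const).clm_apply continuousOn_const

theorem isHermitian_hessMatrix (hF : ContDiffOn ℝ 2
    (fun z : ℝ × E N × E p => F z.1 z.2.1 z.2.2) (Icc 0 1 ×ˢ U.carrier ×ˢ univ)) {x : E N}
    (hx : x ∈ U.carrier) {s : ℝ} (hs : s ∈ Icc (0 : ℝ) 1) (u : E p) :
    (hessMatrix (F s x) u).IsHermitian := by
  have h1 : ContDiff ℝ 2 (F s x) := by
    rw [← contDiffOn_univ]
    exact (contDiffOn_slice hF hx).comp (f := fun u : E p => (s, u))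
      (contDiff_prodMk_right s).contDiffOn fun v _ => ⟨hs, mem_univ v⟩
  have h2 := h1.contDiffAt.isSymmSndFDerivAt (x := u) (by simp)
  ext i j
  simp only [hessMatrix, Matrix.conjTranspose_apply, Matrix.of_apply, star_trivial]
  exact h2 _ _

end Hessian

/-! ### Discrete spectrum in `(-1, 1)` -/

section DiscreteSpectrum

variable {X : Type*} [NormedAddCommGroup X] [InnerProductSpace ℝ X] [CompleteSpace X]
  {κ : Type*} {b : HilbertBasis κ ℝ X} {T : X →L[ℝ] X} {ν : κ → ℝ}

/-- The `ν i` do not accumulate at points of modulus less than `1`, so such a point, if not among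
them, keeps a positive distance from all of them. -/
theorem exists_eq_of_mem_spectrum (hT : ∀ i, T (b i) = ν i • b i)
    (hfin : ∀ a < 1, {i | |ν i| ≤ a}.Finite) {μ : ℝ} (hμ1 : |μ| < 1) (hμ : μ ∈ spectrum ℝ T) :
    ∃ i, ν i = μ := by
  by_contra! h
  obtain ⟨a, ha, ha1⟩ := exists_between hμ1
  obtain ⟨c, hc, hci⟩ := exists_pos_le_abs_sub ha (hfin a ha1)
  exact notMem_spectrum_of_diagonal hT hc (fun i => hci i (h i)) hμ

theorem finite_spectrum_inter_Icc (hT : ∀ i, T (b i) = ν i • b i)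
    (hfin : ∀ a < 1, {i | |ν i| ≤ a}.Finite) {a : ℝ} (ha : a < 1) :
    (spectrum ℝ T ∩ Icc (-a) a).Finite := by
  refine ((hfin a ha).image ν).subset ?_
  rintro μ ⟨hμ, hμa⟩
  have h1 : |μ| ≤ a := abs_le.2 hμa
  obtain ⟨i, rfl⟩ := exists_eq_of_mem_spectrum hT hfin (h1.trans_lt ha) hμ
  exact ⟨i, h1, rfl⟩

theorem exists_spectralSubdivision {L : ℝ → X →L[ℝ] X} (hL : ContinuousOn L (Icc 0 1))
    (hd : ∀ s ∈ Icc (0 : ℝ) 1, ∃ (b : HilbertBasis κ ℝ X) (ν : κ → ℝ),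
      (∀ i, L s (b i) = ν i • b i) ∧ ∀ a < 1, {i | |ν i| ≤ a}.Finite) :
    Nonempty (SpectralSubdivision L) := by
  have hopen : ∀ μ : ℝ, IsOpen {s : Icc (0 : ℝ) 1 | μ ∉ spectrum ℝ (L s)} := by
    intro μ
    simp only [spectrum.notMem_iff]
    have hc : Continuous fun s : Icc (0 : ℝ) 1 => algebraMap ℝ (X →L[ℝ] X) μ - L s :=
      continuous_const.sub (continuousOn_iff_continuous_domRestrict.1 hL)
    exact Units.isOpen.preimage hc
  -- Invertibility is an open condition, so compactness of `[0, 1]` yields a subdivision with one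
  -- admissible `a` on each interval.
  obtain ⟨t, ht0, htm, ⟨m, hm⟩, htc⟩ := exists_monotone_Icc_subset_open_cover_Icc
    (zero_le_one (α := ℝ)) (c := fun a : Ioo (0 : ℝ) 1 =>
      {s : Icc (0 : ℝ) 1 | (a : ℝ) ∉ spectrum ℝ (L s)} ∩
        {s : Icc (0 : ℝ) 1 | -(a : ℝ) ∉ spectrum ℝ (L s)})
    (fun a => (hopen a).inter (hopen (-a))) (by
      rintro s -
      obtain ⟨b, ν, hT, hfin⟩ := hd s s.2
      -- Only finitely many `|ν i|` are at most `1 / 2`, hence some `a` in `(0, 1 / 2)` avoids them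
      -- all.
      obtain ⟨a, ha, hav⟩ := ((Ioo_infinite (one_half_pos (α := ℝ))).sdiff
        ((hfin (1 / 2) one_half_lt_one).image fun i => |ν i|)).nonempty
      have ha1 : a < 1 := ha.2.trans one_half_lt_one
      rw [mem_iUnion]
      refine ⟨⟨a, ha.1, ha1⟩, fun h => ?_, fun h => ?_⟩
      · obtain ⟨i, hi⟩ := exists_eq_of_mem_spectrum hT hfin (by rwa [abs_of_pos ha.1]) h
        have hi' : |ν i| = a := by rw [hi, abs_of_pos ha.1]
        exact hav ⟨i, by rw [mem_ofPred_eq, hi']; exact ha.2.le, hi'⟩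
      · obtain ⟨i, hi⟩ := exists_eq_of_mem_spectrum hT hfin (by rwa [abs_neg, abs_of_pos ha.1]) h
        have hi' : |ν i| = a := by rw [hi, abs_neg, abs_of_pos ha.1]
        exact hav ⟨i, by rw [mem_ofPred_eq, hi']; exact ha.2.le, hi'⟩)
  choose a ha using htc
  have hmem : ∀ j : Fin m, ∀ s ∈ Icc (t j : ℝ) (t (j + 1)),
      s ∈ Icc (0 : ℝ) 1 ∧ (a j : ℝ) ∉ spectrum ℝ (L s) ∧ -(a j : ℝ) ∉ spectrum ℝ (L s) := by
    intro j s hs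
    have hs' : s ∈ Icc (0 : ℝ) 1 := ⟨(t j).2.1.trans hs.1, hs.2.trans (t (j + 1)).2.2⟩
    have := ha j (show (⟨s, hs'⟩ : Icc (0 : ℝ) 1) ∈ Icc (t j) (t (j + 1)) from hs)
    exact ⟨hs', this⟩
  exact ⟨{
    n := m
    t := fun j => t j
    a := fun j => a j
    mono := fun i j hij => htm hij
    t_zero := ht0
    t_last := by simp [hm m le_rfl]
    a_pos := fun j => (a j).2.1
    notMem_pos := fun j s hs => (hmem j s hs).2.1
    notMem_neg := fun j s hs => (hmem j s hs).2.2
    finite_spectrum := fun j s hs => by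
      obtain ⟨b, ν, hT, hfin⟩ := hd s (hmem j s hs).1
      exact finite_spectrum_inter_Icc hT hfin (a j).2.2
    finite_multiplicity := fun j s hs μ hμ => by
      obtain ⟨b, ν, hT, hfin⟩ := hd s (hmem j s hs).1
      refine finiteDimensional_eigenspace hT ((hfin (a j) (a j).2.2).subset fun i hi => ?_)
      rw [mem_ofPred_eq, show ν i = μ from hi]
      exact abs_le.2 hμ }⟩

end DiscreteSpectrum

/-! ### Diagonalisation of the Hessian operator -/

section HessianOp

variable {N : ℕ} [NeZero N] {U : BoundedOpen N} {p : ℕ} {ι : Type*}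

/-- The vector `w ⊗ x` of `H`. -/
def tensor (w : E p) (x : H01 U) : H U p := WithLp.toLp 2 fun k => w k • x

theorem tensor_apply (w : E p) (x : H01 U) (k : Fin p) : tensor w x k = w k • x := rfl

theorem inner_tensor_left (w : E p) (x : H01 U) (u : H U p) :
    inner ℝ (tensor w x) u = ∑ k, w k * inner ℝ x (u k) := by
  rw [PiLp.inner_apply]
  exact Finset.sum_congr rfl fun k _ => real_inner_smul_left _ _ _

theorem inner_tensor (w w' : E p) (x x' : H01 U) :
    inner ℝ (tensor w x) (tensor w' x') = inner ℝ w w' * inner ℝ x x' := by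
  rw [inner_tensor_left, PiLp.inner_apply, Finset.sum_mul]
  refine Finset.sum_congr rfl fun k _ => ?_
  rw [tensor_apply, real_inner_smul_right]
  simp
  ring

/-- The basis of `ℝᵖ` may vary with `i`, so that each block can later be diagonalised in its own
eigenvectors. -/
theorem orthonormal_tensor (b : HilbertBasis ι ℝ (H01 U))
    (w : ι → OrthonormalBasis (Fin p) ℝ (E p)) :
    Orthonormal ℝ fun q : ι × Fin p => tensor (w q.1 q.2) (b q.1) := by
  classical
  rw [orthonormal_iff_ite]
  rintro ⟨i, j⟩ ⟨i', j'⟩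
  rw [inner_tensor, orthonormal_iff_ite.1 b.orthonormal]
  rcases eq_or_ne i i' with rfl | h
  · rw [orthonormal_iff_ite.1 (w i).orthonormal]
    simp
  · simp [h]

theorem span_tensor_orthogonal (b : HilbertBasis ι ℝ (H01 U))
    (w : ι → OrthonormalBasis (Fin p) ℝ (E p)) :
    (Submodule.span ℝ (Set.range fun q : ι × Fin p => tensor (w q.1 q.2) (b q.1)))ᗮ = ⊥ := by
  rw [eq_bot_iff]
  intro u hu
  -- The `i`-th coefficients of the components of `u` form a vector of `ℝᵖ`, which is orthogonal to
  -- the whole basis `w i`.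
  have h1 : ∀ i, (WithLp.toLp 2 fun k => inner ℝ (b i) (u k) : E p) = 0 := by
    intro i
    refine hilbertBasis_ext (b := (w i).toHilbertBasis) fun j => ?_
    have h2 := hu _ (Submodule.subset_span ⟨(i, j), rfl⟩)
    rw [inner_tensor_left] at h2
    rw [OrthonormalBasis.coe_toHilbertBasis, inner_zero_right, PiLp.inner_apply, ← h2]
    exact Finset.sum_congr rfl fun k _ => by simp [mul_comm]
  rw [Submodule.mem_bot]
  ext k
  refine hilbertBasis_ext (b := b) fun i => ?_
  have h3 := congrFun (congrArg WithLp.ofLp (h1 i)) k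
  simpa using h3

/-- The Hilbert basis `w i j ⊗ b i` of `H`. -/
def tensorBasis (b : HilbertBasis ι ℝ (H01 U)) (w : ι → OrthonormalBasis (Fin p) ℝ (E p)) :
    HilbertBasis (ι × Fin p) ℝ (H U p) :=
  HilbertBasis.mkOfOrthogonalEqBot (orthonormal_tensor b w) (span_tensor_orthogonal b w)

theorem tensorBasis_apply (b : HilbertBasis ι ℝ (H01 U))
    (w : ι → OrthonormalBasis (Fin p) ℝ (E p)) (q : ι × Fin p) :
    tensorBasis b w q = tensor (w q.1 q.2) (b q.1) := by
  rw [tensorBasis, HilbertBasis.coe_mkOfOrthogonalEqBot]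

/-- The block decomposition: `massOp U` acts on the factor `x` as the scalar `ν`, so only the matrix
factor is moved. -/
theorem hessianOp_tensor (A B : Matrix (Fin p) (Fin p) ℝ) {x : H01 U} {ν : ℝ}
    (hx : massOp U x = ν • x) (w : E p) :
    hessianOp U A B (tensor w x) = tensor (euclOp (-A - ν • B) w) x := by
  ext k
  have h1 : hessianOp U A B (tensor w x) k = T U A (tensor w x) k + K U B (tensor w x) k := rfl
  have h2 : euclOp (-A - ν • B) w k = ∑ l, (-A - ν • B) k l * w l := rfl
  rw [h1, T, K, matOp_apply, matOp_apply, tensor_apply, h2, Finset.sum_smul,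
    ← Finset.sum_add_distrib]
  refine Finset.sum_congr rfl fun l _ => ?_
  rw [tensor_apply, map_smul, map_smul, hx, ContinuousLinearMap.id_apply]
  simp only [smul_smul, ← add_smul, Matrix.neg_apply, Matrix.sub_apply, Matrix.smul_apply,
    smul_eq_mul]
  congr 1
  ring

theorem isHermitian_pencil {A B : Matrix (Fin p) (Fin p) ℝ} (hA : A.IsHermitian)
    (hB : B.IsHermitian) (x : ℝ) : (-A - x • B).IsHermitian :=
  hA.neg.sub (hB.smul (IsSelfAdjoint.all x))

/-- The eigenvectors of the Hessian operator. -/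
def hessianBasis (b : HilbertBasis ι ℝ (H01 U)) (ν : ι → ℝ) {A B : Matrix (Fin p) (Fin p) ℝ}
    (hA : A.IsHermitian) (hB : B.IsHermitian) : HilbertBasis (ι × Fin p) ℝ (H U p) :=
  tensorBasis b fun i => (isHermitian_pencil hA hB (ν i)).eigenvectorBasis

/-- The eigenvalues of the Hessian operator. -/
def hessianEigenvalue (ν : ι → ℝ) {A B : Matrix (Fin p) (Fin p) ℝ}
    (hA : A.IsHermitian) (hB : B.IsHermitian) (q : ι × Fin p) : ℝ :=
  (isHermitian_pencil hA hB (ν q.1)).eigenvalues q.2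

theorem hessianOp_hessianBasis {b : HilbertBasis ι ℝ (H01 U)} {ν : ι → ℝ}
    (hb : ∀ i, massOp U (b i) = ν i • b i) {A B : Matrix (Fin p) (Fin p) ℝ}
    (hA : A.IsHermitian) (hB : B.IsHermitian) (q : ι × Fin p) :
    hessianOp U A B (hessianBasis b ν hA hB q) =
      hessianEigenvalue ν hA hB q • hessianBasis b ν hA hB q := by
  rw [hessianBasis, tensorBasis_apply, hessianOp_tensor A B (hb q.1)]
  have h := euclOp_eigenvectorBasis (isHermitian_pencil hA hB (ν q.1)) q.2
  rw [OrthonormalBasis.coe_toHilbertBasis] at h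
  rw [h]
  ext k
  simp only [tensor_apply, PiLp.smul_apply, hessianEigenvalue, smul_eq_mul, mul_smul]

theorem isHermitian_signMatrix (p p₁ : ℕ) : (signMatrix p p₁).IsHermitian :=
  Matrix.isHermitian_diagonal _

theorem norm_euclOp_neg_signMatrix (p p₁ : ℕ) (w : E p) :
    ‖euclOp (-signMatrix p p₁) w‖ = ‖w‖ := by
  rw [EuclideanSpace.norm_eq, EuclideanSpace.norm_eq]
  congr 1
  refine Finset.sum_congr rfl fun k _ => ?_
  have h : euclOp (-signMatrix p p₁) w k = -((if (k : ℕ) < p₁ then -1 else 1) * w k) := by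
    change (-signMatrix p p₁).mulVec w.ofLp k = _
    rw [Matrix.neg_mulVec, Pi.neg_apply, signMatrix, Matrix.mulVec_diagonal]
  rw [h]
  split_ifs <;> simp

/-- For a unit eigenvector `w`, the vector `A w` has norm `1` and `x • B w` has norm at most `x *
‖B‖`. -/
theorem le_abs_eigenvalues_pencil {p₁ : ℕ} {B : Matrix (Fin p) (Fin p) ℝ} {x : ℝ} (hx : 0 ≤ x)
    (hM : (-signMatrix p p₁ - x • B).IsHermitian) (j : Fin p) :
    1 - x * ‖euclOp B‖ ≤ |hM.eigenvalues j| := by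
  set w := hM.eigenvectorBasis j with hw
  have h := euclOp_eigenvectorBasis hM j
  rw [OrthonormalBasis.coe_toHilbertBasis, ← hw] at h
  have hw1 : ‖w‖ = 1 := hM.eigenvectorBasis.orthonormal.1 j
  have h1 : euclOp (-signMatrix p p₁ - x • B) w =
      euclOp (-signMatrix p p₁) w - x • euclOp B w := by
    rw [euclOp, map_sub, map_smul]
    rfl
  have h2 : ‖euclOp (-signMatrix p p₁ - x • B) w‖ = |hM.eigenvalues j| := by
    rw [h, norm_smul, hw1, mul_one, Real.norm_eq_abs]
  rw [← h2, h1]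
  refine le_trans ?_ (norm_sub_norm_le _ _)
  rw [norm_euclOp_neg_signMatrix, hw1, norm_smul, Real.norm_of_nonneg hx]
  have h3 := (euclOp B).le_opNorm w
  rw [hw1, mul_one] at h3
  linarith [mul_le_mul_of_nonneg_left h3 hx]

theorem sgn_pencil_eq {p₁ : ℕ} {B : Matrix (Fin p) (Fin p) ℝ} (hB : B.IsHermitian) {x : ℝ}
    (hx : 0 ≤ x) (hx1 : x * ‖euclOp B‖ < 1) :
    sgn (-signMatrix p p₁ - x • B) = sgn (-signMatrix p p₁) := by
  have hA := isHermitian_signMatrix p p₁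
  refine sgn_eq_of_norm_sub_lt hA.neg (isHermitian_pencil hA hB x) (c := 1) (fun i => ?_) ?_
  -- The pencil estimate at `x = 0` supplies the gap `1` for `-A`.
  · have h0 : (-signMatrix p p₁ - (0 : ℝ) • B).IsHermitian := isHermitian_pencil hA hB 0
    have h1 := le_abs_eigenvalues_pencil le_rfl h0 i
    simpa using h1
  · have : euclOp (-signMatrix p p₁ - x • B) - euclOp (-signMatrix p p₁) = -(x • euclOp B) := by
      rw [euclOp, map_sub, map_smul]
      abel
    rw [this, norm_neg, norm_smul, Real.norm_of_nonneg hx]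
    exact hx1

/-- An eigenvalue of modulus at most `a` forces `1 - ν i * ‖B‖ ≤ a`; this bounds `ν i` away from `0`
and leaves finitely many blocks. -/
theorem finite_hessianEigenvalue_le {b : HilbertBasis ι ℝ (H01 U)} {ν : ι → ℝ}
    (hb : ∀ i, massOp U (b i) = ν i • b i) {p₁ : ℕ} {B : Matrix (Fin p) (Fin p) ℝ}
    (hB : B.IsHermitian) {a : ℝ} (ha : a < 1) :
    {q | |hessianEigenvalue ν (isHermitian_signMatrix p p₁) hB q| ≤ a}.Finite := by
  have hε : 0 < (1 - a) / (‖euclOp B‖ + 1) := div_pos (by linarith) (by positivity)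
  refine ((massOp_finite_ge hb hε).prod (Set.finite_univ (α := Fin p))).subset fun q hq => ?_
  refine ⟨?_, mem_univ _⟩
  have h0 := massOp_eigenvalue_nonneg hb q.1
  have h1 := le_abs_eigenvalues_pencil h0
    (isHermitian_pencil (isHermitian_signMatrix p p₁) hB (ν q.1)) q.2
  have h2 : 1 - ν q.1 * ‖euclOp B‖ ≤ a := h1.trans hq
  rw [mem_ofPred_eq, div_le_iff₀ (by positivity)]
  linarith

theorem continuous_matOp (S : H01 U →L[ℝ] H01 U) :
    Continuous fun M : Matrix (Fin p) (Fin p) ℝ => matOp M S := by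
  let Φ : Matrix (Fin p) (Fin p) ℝ →ₗ[ℝ] (H U p →L[ℝ] H U p) :=
    { toFun := fun M => matOp M S
      map_add' := fun M M' => by
        ext u i
        simp only [matOp_apply, add_apply, PiLp.add_apply, Matrix.add_apply, add_smul,
          Finset.sum_add_distrib]
      map_smul' := fun c M => by
        ext u i
        simp only [matOp_apply, smul_apply, PiLp.smul_apply, Matrix.smul_apply, smul_eq_mul,
          mul_smul, Finset.smul_sum, RingHom.id_apply] }
  exact Φ.continuous_of_finiteDimensional

theorem continuous_hessianOp (A : Matrix (Fin p) (Fin p) ℝ) :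
    Continuous fun B : Matrix (Fin p) (Fin p) ℝ => hessianOp U A B :=
  continuous_const.add ((continuous_matOp (massOp U)).comp continuous_neg)

theorem isWeakSolution_of_hessianOp_eq_zero {A B : Matrix (Fin p) (Fin p) ℝ} {u : H U p}
    (hu : hessianOp U A B u = 0) : IsWeakSolution U A B u := by
  intro v
  have h1 : inner ℝ (T U A u) v = -∑ i, ∑ j, A i j * inner ℝ (u j) (v i) := by
    rw [PiLp.inner_apply, ← Finset.sum_neg_distrib]
    refine Finset.sum_congr rfl fun i _ => ?_
    rw [T, matOp_apply, sum_inner, ← Finset.sum_neg_distrib]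
    refine Finset.sum_congr rfl fun j _ => ?_
    rw [real_inner_smul_left, Matrix.neg_apply, neg_mul, ContinuousLinearMap.id_apply]
  have h2 : inner ℝ (T U A u) v + inner ℝ (K U B u) v = 0 := by
    rw [← inner_add_left]
    have : T U A u + K U B u = 0 := hu
    rw [this, inner_zero_left]
  rw [inner_K, h1] at h2
  linarith

theorem hessianEigenvalue_ne_zero {b : HilbertBasis ι ℝ (H01 U)} {ν : ι → ℝ}
    (hb : ∀ i, massOp U (b i) = ν i • b i) {A B : Matrix (Fin p) (Fin p) ℝ}
    (hA : A.IsHermitian) (hB : B.IsHermitian)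
    (h : ∀ u : H U p, IsWeakSolution U A B u → u = 0) (q : ι × Fin p) :
    hessianEigenvalue ν hA hB q ≠ 0 := by
  intro h0
  refine (hessianBasis b ν hA hB).orthonormal.ne_zero q
    (h _ (isWeakSolution_of_hessianOp_eq_zero ?_))
  rw [hessianOp_hessianBasis hb, h0, zero_smul]

theorem isUnit_hessianOp {b : HilbertBasis ι ℝ (H01 U)} {ν : ι → ℝ}
    (hb : ∀ i, massOp U (b i) = ν i • b i) {p₁ : ℕ} {B : Matrix (Fin p) (Fin p) ℝ}
    (hB : B.IsHermitian)
    (h : ∀ u : H U p, IsWeakSolution U (signMatrix p p₁) B u → u = 0) :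
    IsUnit (hessianOp U (signMatrix p p₁) B) := by
  have hA := isHermitian_signMatrix p p₁
  obtain ⟨c, hc, hci⟩ := exists_pos_le_abs_sub (μ := 0) (a := 1 / 2) (by simp)
    (finite_hessianEigenvalue_le hb (p₁ := p₁) hB one_half_lt_one)
  exact isUnit_of_diagonal (hessianOp_hessianBasis hb hA hB) hc fun q => by
    simpa using hci q (hessianEigenvalue_ne_zero hb hA hB h q)

theorem isFredholmPath_hessianOp {b : HilbertBasis ι ℝ (H01 U)} {ν : ι → ℝ}
    (hb : ∀ i, massOp U (b i) = ν i • b i) {p₁ : ℕ} {B : ℝ → Matrix (Fin p) (Fin p) ℝ}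
    (hBc : ContinuousOn B (Icc 0 1)) (hB : ∀ s ∈ Icc (0 : ℝ) 1, (B s).IsHermitian)
    (h0 : ∀ u : H U p, IsWeakSolution U (signMatrix p p₁) (B 0) u → u = 0)
    (h1 : ∀ u : H U p, IsWeakSolution U (signMatrix p p₁) (B 1) u → u = 0) :
    IsFredholmPath fun s => hessianOp U (signMatrix p p₁) (B s) where
  continuousOn := (continuous_hessianOp _).comp_continuousOn hBc
  selfAdjoint s hs := isSelfAdjoint_of_diagonal
    (hessianOp_hessianBasis hb (isHermitian_signMatrix p p₁) (hB s hs))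
  closed_range s hs := by
    obtain ⟨c, hc, hci⟩ := exists_pos_le_abs_sub (μ := 0) (a := 1 / 2) (by simp)
      (finite_hessianEigenvalue_le hb (p₁ := p₁) (hB s hs) one_half_lt_one)
    exact isClosed_range_of_diagonal
      (hessianOp_hessianBasis hb (isHermitian_signMatrix p p₁) (hB s hs)) hc fun q hq => by
        simpa using hci q hq
  finite_ker s hs := by
    rw [← Module.End.eigenspace_zero]
    refine finiteDimensional_eigenspace
      (hessianOp_hessianBasis hb (isHermitian_signMatrix p p₁) (hB s hs))
      ((finite_hessianEigenvalue_le hb (p₁ := p₁) (hB s hs) one_half_lt_one).subset fun q hq => ?_)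
    rw [mem_ofPred_eq, show hessianEigenvalue ν _ _ q = 0 from hq]
    norm_num
  isUnit_zero := isUnit_hessianOp hb (hB 0 (by simp)) h0
  isUnit_one := isUnit_hessianOp hb (hB 1 (by simp)) h1

end HessianOp

/-! ### The spectral flow formula -/

section Flow

variable {N : ℕ} [NeZero N] {U : BoundedOpen N} {p : ℕ} {ι : Type*}

theorem ncard_eq_sum_fiber {W : Set ℝ} {lam : ι × Fin p → ℝ} (hfin : {q | lam q ∈ W}.Finite)
    {G : Finset ι} (hG : ∀ q, lam q ∈ W → q.1 ∈ G) :
    {q | lam q ∈ W}.ncard = ∑ i ∈ G, {j | lam (i, j) ∈ W}.ncard := by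
  classical
  rw [Set.ncard_eq_toFinset_card _ hfin,
    Finset.card_eq_sum_card_fiberwise (f := Prod.fst) (t := G) fun q hq => hG q (by simpa using hq)]
  refine Finset.sum_congr rfl fun i _ => ?_
  rw [← Set.ncard_image_of_injective {j | lam (i, j) ∈ W} (Prod.mk_right_injective i),
    ← Set.ncard_coe_finset]
  congr 1
  ext ⟨i', j⟩
  simp only [Finset.coe_filter, Finite.mem_toFinset, mem_ofPred_eq, mem_image, Prod.mk.injEq]
  constructor
  · rintro ⟨h, rfl⟩
    exact ⟨j, h, rfl, rfl⟩
  · rintro ⟨j', h, rfl, rfl⟩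
    exact ⟨h, rfl⟩

theorem sum_fin_succ_sub_castSucc {M : Type*} [AddCommGroup M] {n : ℕ} (f : Fin (n + 1) → M) :
    ∑ j : Fin n, (f j.succ - f j.castSucc) = f (Fin.last n) - f 0 := by
  have h1 := Fin.sum_univ_succ f
  rw [Fin.sum_univ_castSucc f] at h1
  rw [Finset.sum_sub_distrib, sub_eq_sub_iff_add_eq_add, add_comm _ (f 0), ← h1, add_comm]

theorem dirichletEigenvalue_nonneg (k : ℕ) : 0 ≤ dirichletEigenvalue U k := by
  refine Real.sInf_nonneg fun a ha => ?_
  by_contra! h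
  rw [mem_ofPred_eq, rank_dirichlet_of_nonpos h.le] at ha
  simp at ha

/-- The contribution of an eigenvalue `x` of `massOp U` to twice the index. -/
def pencilTerm (A B : Matrix (Fin p) (Fin p) ℝ) (x : ℝ) : ℤ := sgn (-A - x • B) - sgn (-A)

theorem pencilTerm_eq_zero {p₁ : ℕ} {B : Matrix (Fin p) (Fin p) ℝ} (hB : B.IsHermitian) {x : ℝ}
    (hx : 0 ≤ x) (hx1 : x < 1 / (‖euclOp B‖ + 1)) : pencilTerm (signMatrix p p₁) B x = 0 := by
  rw [lt_div_iff₀ (by positivity)] at hx1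
  rw [pencilTerm, sgn_pencil_eq hB hx (by linarith), sub_self]

theorem finite_support_indexTerm {b : HilbertBasis ι ℝ (H01 U)} {ν : ι → ℝ}
    (hb : ∀ i, massOp U (b i) = ν i • b i) {p₁ : ℕ} {B : Matrix (Fin p) (Fin p) ℝ}
    (hB : B.IsHermitian) : (Function.support (indexTerm U (signMatrix p p₁) B)).Finite := by
  have hε : 0 < 1 / (‖euclOp B‖ + 1) := by positivity
  refine (Set.finite_Iio {i | 1 / (‖euclOp B‖ + 1) ≤ ν i}.ncard).subset fun k hk => ?_
  rw [mem_Iio, ← le_one_div_dirichletEigenvalue_iff hb hε]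
  by_contra! hlt
  exact hk (pencilTerm_eq_zero hB (one_div_nonneg.2 (dirichletEigenvalue_nonneg k)) hlt)

theorem finsum_indexTerm {b : HilbertBasis ι ℝ (H01 U)} {ν : ι → ℝ}
    (hb : ∀ i, massOp U (b i) = ν i • b i) {p₁ : ℕ} {B : Matrix (Fin p) (Fin p) ℝ}
    (hB : B.IsHermitian) : ∑ᶠ k, indexTerm U (signMatrix p p₁) B k =
      ∑ᶠ i, pencilTerm (signMatrix p p₁) B (ν i) := by
  have hε : 0 < 1 / (‖euclOp B‖ + 1) := by positivity
  -- The term is known to vanish only for `0 ≤ y < 1 / (‖B‖ + 1)`. Inserting `max 0 y` covers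
  -- negative `y` and changes neither sum, both families being nonnegative.
  have h := finsum_dirichletEigenvalue hb hε
    (f := fun y => pencilTerm (signMatrix p p₁) B (max 0 y))
    fun y hy => pencilTerm_eq_zero hB (le_max_left _ _) (max_lt hε hy)
  simp only [max_eq_right (massOp_eigenvalue_nonneg hb _),
    max_eq_right (one_div_nonneg.2 (dirichletEigenvalue_nonneg (U := U) _))] at h
  exact h

/-- On the eigenspace of `massOp U` for `x`, the flow through one interval of a subdivision is the
change of the number of nonnegative eigenvalues. -/
theorem countP_Icc_sub_eq {A : Matrix (Fin p) (Fin p) ℝ} {B : ℝ → Matrix (Fin p) (Fin p) ℝ}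
    {t t' a x : ℝ} (htt' : t ≤ t') (ha : 0 ≤ a) (hA : A.IsHermitian)
    (hBc : ContinuousOn B (Icc t t')) (hB : ∀ s ∈ Icc t t', (B s).IsHermitian)
    (hroots : ∀ s ∈ Icc t t', a ∉ (-A - x • B s).charpoly.roots) :
    ((-A - x • B t').charpoly.roots.countP (· ∈ Icc 0 a) : ℤ) -
        (-A - x • B t).charpoly.roots.countP (· ∈ Icc 0 a) =
      (-A - x • B t').charpoly.roots.countP (0 ≤ ·) -
        (-A - x • B t).charpoly.roots.countP (0 ≤ ·) := by
  -- No eigenvalue crosses `a`, so the number above `a` agrees at `t` and `t'` and cancels.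
  have h1 := countP_gt_const (M := fun s => -A - x • B s) isPreconnected_Icc
    (continuousOn_const.sub (hBc.const_smul x)) (fun s hs => isHermitian_pencil hA (hB s hs) x)
    hroots (left_mem_Icc.2 htt') (right_mem_Icc.2 htt')
  have h2 := countP_Icc_add_countP_gt (-A - x • B t).charpoly.roots ha
  have h3 := countP_Icc_add_countP_gt (-A - x • B t').charpoly.roots ha
  omega

theorem two_mul_flow {b : HilbertBasis ι ℝ (H01 U)} {ν : ι → ℝ}
    (hb : ∀ i, massOp U (b i) = ν i • b i) {p₁ : ℕ} {B : ℝ → Matrix (Fin p) (Fin p) ℝ}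
    (hBc : ContinuousOn B (Icc 0 1)) (hB : ∀ s ∈ Icc (0 : ℝ) 1, (B s).IsHermitian)
    (h0 : ∀ u : H U p, IsWeakSolution U (signMatrix p p₁) (B 0) u → u = 0)
    (h1 : ∀ u : H U p, IsWeakSolution U (signMatrix p p₁) (B 1) u → u = 0)
    (P : SpectralSubdivision fun s => hessianOp U (signMatrix p p₁) (B s)) :
    2 * P.flow = ∑ᶠ i, pencilTerm (signMatrix p p₁) (B 1) (ν i) -
      ∑ᶠ i, pencilTerm (signMatrix p p₁) (B 0) (ν i) := by
  classical
  have hA : (signMatrix p p₁).IsHermitian := isHermitian_signMatrix p p₁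
  have ht : ∀ j, P.t j ∈ Icc (0 : ℝ) 1 := fun j => by
    rw [← P.t_zero, ← P.t_last]
    exact ⟨P.mono (Fin.zero_le j), P.mono (Fin.le_last j)⟩
  have hle : ∀ j : Fin P.n, P.t j.castSucc ≤ P.t j.succ := fun j =>
    P.mono (Fin.castSucc_lt_succ).le
  have hsub : ∀ j : Fin P.n, Icc (P.t j.castSucc) (P.t j.succ) ⊆ Icc 0 1 := fun j =>
    Icc_subset_Icc (ht _).1 (ht _).2
  -- the basis vectors counted at the endpoints of the intervals
  have hfin : ∀ j : Fin P.n, ∀ s (hs : s ∈ Icc (P.t j.castSucc) (P.t j.succ)),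
      {q | hessianEigenvalue ν hA (hB s (hsub j hs)) q ∈ Icc 0 (P.a j)}.Finite := by
    intro j s hs
    have hIcc : Icc 0 (P.a j) ⊆ Icc (-P.a j) (P.a j) :=
      Icc_subset_Icc_left (neg_nonpos.2 (P.a_pos j).le)
    -- An arbitrary subdivision is not required to have `a j < 1`, so finiteness is drawn from its
    -- own spectral conditions.
    exact finite_of_finite_eigenspace (hessianOp_hessianBasis hb hA (hB s (hsub j hs)))
      ((P.finite_spectrum j s hs).subset (inter_subset_inter_right _ hIcc))
      fun μ hμ => P.finite_multiplicity j s hs μ (hIcc hμ)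
  have hl : ∀ j : Fin P.n, P.t j.castSucc ∈ Icc (P.t j.castSucc) (P.t j.succ) := fun j =>
    left_mem_Icc.2 (hle j)
  have hr : ∀ j : Fin P.n, P.t j.succ ∈ Icc (P.t j.castSucc) (P.t j.succ) := fun j =>
    right_mem_Icc.2 (hle j)
  -- Blocks with `ν i < ε` contribute to neither index.
  obtain ⟨ε, hε, hε0, hε1⟩ : ∃ ε > 0, ε ≤ 1 / (‖euclOp (B 0)‖ + 1) ∧
      ε ≤ 1 / (‖euclOp (B 1)‖ + 1) :=
    ⟨_, lt_min (by positivity) (by positivity), min_le_left _ _, min_le_right _ _⟩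
  -- One finite set of blocks serves both sides: it contains all those relevant to the indices and
  -- all those with an eigenvalue in `[0, a j]` at an end of some interval.
  obtain ⟨G, hGε, hGl, hGr⟩ : ∃ G : Finset ι, (∀ i, ε ≤ ν i → i ∈ G) ∧
      (∀ j q, hessianEigenvalue ν hA (hB _ (hsub j (hl j))) q ∈ Icc 0 (P.a j) → q.1 ∈ G) ∧
      (∀ j q, hessianEigenvalue ν hA (hB _ (hsub j (hr j))) q ∈ Icc 0 (P.a j) → q.1 ∈ G) := by
    refine ⟨(massOp_finite_ge hb hε).toFinset ∪
      (Finset.univ.biUnion fun j => (hfin j _ (hl j)).toFinset.image Prod.fst ∪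
        (hfin j _ (hr j)).toFinset.image Prod.fst), fun i hi => ?_, fun j q hq => ?_,
        fun j q hq => ?_⟩
    · exact Finset.mem_union_left _ (by simpa using hi)
    · refine Finset.mem_union_right _ (Finset.mem_biUnion.2 ⟨j, Finset.mem_univ j,
        Finset.mem_union_left _ (Finset.mem_image_of_mem _ ((Set.Finite.mem_toFinset _).2 hq))⟩)
    · refine Finset.mem_union_right _ (Finset.mem_biUnion.2 ⟨j, Finset.mem_univ j,
        Finset.mem_union_right _ (Finset.mem_image_of_mem _ ((Set.Finite.mem_toFinset _).2 hq))⟩)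
  have hdim : ∀ j : Fin P.n, ∀ s (hs : s ∈ Icc (P.t j.castSucc) (P.t j.succ)),
      (∀ q, hessianEigenvalue ν hA (hB s (hsub j hs)) q ∈ Icc 0 (P.a j) → q.1 ∈ G) →
      Module.finrank ℝ (spectralSpace (hessianOp U (signMatrix p p₁) (B s)) (P.a j)) =
        ∑ i ∈ G, (-signMatrix p p₁ - ν i • B s).charpoly.roots.countP (· ∈ Icc 0 (P.a j)) := by
    intro j s hs hG
    rw [spectralSpace, finrank_iSup_eigenspace (hessianOp_hessianBasis hb hA (hB s (hsub j hs)))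
      (hfin j s hs), ncard_eq_sum_fiber (hfin j s hs) hG]
    refine Finset.sum_congr rfl fun i _ => ?_
    rw [countP_roots_charpoly (isHermitian_pencil hA (hB s (hsub j hs)) (ν i))]
    rfl
  have hroots : ∀ i, ∀ j : Fin P.n, ∀ s ∈ Icc (P.t j.castSucc) (P.t j.succ),
      P.a j ∉ (-signMatrix p p₁ - ν i • B s).charpoly.roots := by
    intro i j s hs hmem
    obtain ⟨k, hk⟩ := exists_eigenvalues_eq (isHermitian_pencil hA (hB s (hsub j hs)) (ν i)) hmem
    refine P.notMem_pos j s hs ?_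
    rw [← hk]
    exact mem_spectrum_of_diagonal (hessianOp_hessianBasis hb hA (hB s (hsub j hs))) (i, k)
  have hflow : P.flow = ∑ i ∈ G,
      (((-signMatrix p p₁ - ν i • B 1).charpoly.roots.countP (0 ≤ ·) : ℤ) -
      (-signMatrix p p₁ - ν i • B 0).charpoly.roots.countP (0 ≤ ·)) := by
    have e1 : P.flow = ∑ j : Fin P.n, ∑ i ∈ G,
        (((-signMatrix p p₁ - ν i • B (P.t j.succ)).charpoly.roots.countP (0 ≤ ·) : ℤ) -
          (-signMatrix p p₁ - ν i • B (P.t j.castSucc)).charpoly.roots.countP (0 ≤ ·)) := by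
      refine Finset.sum_congr rfl fun j _ => ?_
      rw [hdim j _ (hl j) (hGl j), hdim j _ (hr j) (hGr j)]
      push_cast
      rw [← Finset.sum_sub_distrib]
      exact Finset.sum_congr rfl fun i _ => countP_Icc_sub_eq (hle j) (P.a_pos j).le hA
        (hBc.mono (hsub j)) (fun s hs => hB s (hsub j hs)) (hroots i j)
    rw [e1, Finset.sum_comm]
    refine Finset.sum_congr rfl fun i _ => ?_
    -- With `a j` gone, the contributions of a fixed block telescope.
    have e2 := sum_fin_succ_sub_castSucc fun j =>
      ((-signMatrix p p₁ - ν i • B (P.t j)).charpoly.roots.countP (0 ≤ ·) : ℤ)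
    rw [P.t_last, P.t_zero] at e2
    exact e2
  have hsgn : ∀ s (hs : s ∈ Icc (0 : ℝ) 1),
      (∀ u : H U p, IsWeakSolution U (signMatrix p p₁) (B s) u → u = 0) →
      ∀ i, pencilTerm (signMatrix p p₁) (B s) (ν i) =
        2 * ((-signMatrix p p₁ - ν i • B s).charpoly.roots.countP (0 ≤ ·) : ℤ) - p -
          sgn (-signMatrix p p₁) := by
    intro s hs h i
    have hM := isHermitian_pencil hA (hB s hs) (ν i)
    rw [pencilTerm, sgn_eq_of_zero_notMem_roots hM fun hmem => ?_]
    obtain ⟨k, hk⟩ := exists_eigenvalues_eq hM hmem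
    exact hessianEigenvalue_ne_zero hb hA (hB s hs) h (i, k) hk
  have hsum : ∀ s (hs : s ∈ Icc (0 : ℝ) 1), ε ≤ 1 / (‖euclOp (B s)‖ + 1) →
      ∑ᶠ i, pencilTerm (signMatrix p p₁) (B s) (ν i) =
        ∑ i ∈ G, pencilTerm (signMatrix p p₁) (B s) (ν i) := by
    intro s hs hεs
    refine finsum_eq_sum_of_support_subset _ fun i hi => hGε i ?_
    by_contra! hlt
    exact hi (pencilTerm_eq_zero (hB s hs) (massOp_eigenvalue_nonneg hb i) (hlt.trans_le hεs))
  rw [hsum 1 (by simp) hε1, hsum 0 (by simp) hε0, hflow, Finset.mul_sum, ← Finset.sum_sub_distrib]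
  refine Finset.sum_congr rfl fun i _ => ?_
  rw [hsgn 1 (by simp) h1, hsgn 0 (by simp) h0]
  ring

end Flow

end EllipticSF

end

/-! ### Assembly of the spectral flow formula. -/

theorem theorem4p2 {N : ℕ} [NeZero N] (U : BoundedOpen N) (p p₁ : ℕ) (hp₁ : p₁ ≤ p)
    (F : ℝ → E N → E p → ℝ) (B : ℝ → Matrix (Fin p) (Fin p) ℝ)
    (hA1 : ContDiffOn ℝ 2 (fun z : ℝ × E N × E p => F z.1 z.2.1 z.2.2)
      (Set.Icc 0 1 ×ˢ U.carrier ×ˢ Set.univ))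
    (hA2 : ∀ s ∈ Set.Icc (0 : ℝ) 1, ∀ x ∈ U.carrier, fderiv ℝ (F s x) 0 = 0)
    (hA3 : 2 ≤ N → ∃ C > (0 : ℝ), ∃ r : ℝ, 1 ≤ r ∧
      (3 ≤ N → r < ((N : ℝ) + 2) / ((N : ℝ) - 2)) ∧
      ∀ s ∈ Set.Icc (0 : ℝ) 1, ∀ x ∈ U.carrier, ∀ u : E p, ∀ i j,
        |hessMatrix (F s x) u i j| ≤ C * (1 + ‖u‖ ^ (r - 1)))
    (hB : ∀ s ∈ Set.Icc (0 : ℝ) 1, ∀ x ∈ U.carrier, hessMatrix (F s x) 0 = B s)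
    (h0 : ∀ u : H U p, IsWeakSolution U (signMatrix p p₁) (B 0) u → u = 0)
    (h1 : ∀ u : H U p, IsWeakSolution U (signMatrix p p₁) (B 1) u → u = 0) :
    (∀ s ∈ Set.Icc (0 : ℝ) 1,
      (Function.support (indexTerm U (signMatrix p p₁) (B s))).Finite) ∧
    IsFredholmPath (fun s => hessianOp U (signMatrix p p₁) (B s)) ∧
    SpectralFlowWellDefined (fun s => hessianOp U (signMatrix p p₁) (B s)) ∧
    (spectralFlow (fun s => hessianOp U (signMatrix p p₁) (B s)) : ℝ) =
      index U (signMatrix p p₁) (B 1) - index U (signMatrix p p₁) (B 0) := by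
  -- A single point of `U` suffices to transfer continuity and symmetry from the Hessian of `F` to
  -- `B`.
  obtain ⟨x, hx⟩ := U.nonempty
  have hBc : ContinuousOn B (Set.Icc 0 1) :=
    (continuousOn_hessMatrix hA1 hx 0).congr fun s hs => (hB s hs x hx).symm
  have hBs : ∀ s ∈ Set.Icc (0 : ℝ) 1, (B s).IsHermitian := fun s hs => by
    rw [← hB s hs x hx]
    exact isHermitian_hessMatrix hA1 hx hs 0
  obtain ⟨ι, b, ν, hb⟩ :=
    exists_hilbertBasis_eigenvectors (isCompactOperator_massOp U) (isSymmetric_massOp U)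
  have hF := isFredholmPath_hessianOp hb hBc hBs h0 h1
  have hne : Nonempty (SpectralSubdivision fun s => hessianOp U (signMatrix p p₁) (B s)) :=
    exists_spectralSubdivision hF.continuousOn fun s hs =>
      ⟨_, _, hessianOp_hessianBasis hb (isHermitian_signMatrix p p₁) (hBs s hs),
        fun _ ha => finite_hessianEigenvalue_le hb (hBs s hs) ha⟩
  have hflow := two_mul_flow hb hBc hBs h0 h1
  have hsf : spectralFlow (fun s => hessianOp U (signMatrix p p₁) (B s)) = hne.some.flow :=
    dif_pos hne
  refine ⟨fun s hs => finite_support_indexTerm hb (hBs s hs), hF, ⟨hne, fun P => ?_⟩, ?_⟩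
  -- Twice the flow of any subdivision equals the same expression, in which the subdivision does not
  -- occur.
  · rw [hsf]
    have e1 := hflow P
    have e2 := hflow hne.some
    omega
  · have e := hflow hne.some
    rw [← finsum_indexTerm hb (hBs 1 (by simp)), ← finsum_indexTerm hb (hBs 0 (by simp))] at e
    have e' := congrArg (Int.cast (R := ℝ)) e
    push_cast at e'
    rw [hsf, index, index]
    linarith
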